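/- **Setting.** Let $T^1,\dots,T^8$ be Hermitian traceless $3\times 3$ matrices with $\operatorname{tr}(T^AT^B)=\frac12\delta_{AB}$ (generators of $SU(3)$). Let $a_A,a_A^\dagger$ ($1\le A\le 8$) be the annihilation and creation operators of eight independent bosonic oscillators, $[a_A,a_B^\dagger]=\delta_{AB}$, acting on the bosonic Fock space with normalized vacuum $|0\rangle$, and put $a=\sum_A a_AT^A$, $a^\dagger=\sum_A a^\dagger_AT^A$ (operator-valued matrices) and $$H=\operatorname{tr}(a^\dagger a)+2-\tfrac12\operatorname{tr}(a^\dagger a^\dagger)-\tfrac12\operatorname{tr}(aa).$$ Let $|j,k\rangle=(\operatorname{tr}a^\dagger a^\dagger)^j(\operatorname{tr}a^\dagger a^\dagger a^\dagger)^k|0\rangle$ and $$\overline{|n,2\kappa\rangle}=|n,2\kappa\rangle+\sum_{t=1}^{\kappa}\Gamma_{\kappa,\kappa-t}\,|n+3t,2\kappa-2t\rangle,\qquad \Gamma_{\kappa,t}=(-24)^{t-\kappa}\frac{(\kappa+t)!}{(\kappa-t)!\,(2t)!}.$$ Let $\mathcal L_n^{a}(x)=\sum_{i=0}^n(-1)^i\binom{n+a}{n-i}\frac{x^i}{i!}$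 be the generalized Laguerre polynomials and $L_n^a=\mathcal L_n^a/(n+a)!$. Fix a cut-off $N\in\mathbb N$, let $0\le\kappa\le\lfloor N/6\rfloor$, and put $d_\kappa=\lfloor (N-6\kappa)/2\rfloor+1$. For real $E$ let $$|E,\kappa\rangle=(2E)^{3\kappa}e^{-E}\sum_{n=0}^{d_\kappa-1}L_n^{6\kappa+3}(2E)\,\overline{|n,2\kappa\rangle}.$$ The even sector at cut-off $N$ is the span of the Fock states $|j,2k\rangle$ with $2j+6k\le N$, and the Hamiltonian at cut-off $N$ is $P_NH$, where $P_N$ is the projection onto states with at most $N$ quanta. **Claim.** 1. For all $\alpha,\beta,n,m\ge0$: $\ \overline{\langle n,2\alpha|}\,\overline{m,2\beta\rangle}=\delta_{\alpha\beta}\,\delta_{nm}\,\mathcal N^\alpha(n)$ with $\mathcal N^\alpha(n)=\frac16\,\frac1{24^{2\alpha}}\,n!\,(n+6\alpha+3)!$. 2. For each $\kappa\le\lfloor N/6\rfloor$ the polynomial $\mathcal L_{d_\kappa}^{6\kappa+3}$ has degree $d_\kappa$, and it has $d_\kappa$ real roots, which are simple and positive. Hence the solutions of the quantization condition $L_{d_\kappa}^{6\kappa+3}(2E)=0$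 are uniquely $E_{\kappa,1}<\dots<E_{\kappa,d_\kappa}$. 3. Each vector $|E_{\kappa,m},\kappa\rangle$ ($0\le\kappa\le\lfloor N/6\rfloor$, $1\le m\le d_\kappa$) is a nonzero eigenvector of $P_NH$ with eigenvalue $E_{\kappa,m}$. These vectors are mutually orthogonal, across families $\kappa$ and within each family, and for $E=E_{\kappa,m}$, $d=d_\kappa$, $$\langle E,\kappa|E,\kappa\rangle=e^{-2E}(2E)^{6\kappa}\,\frac16\,\frac1{24^{2\kappa}}\,\frac{d!}{(d+6\kappa+2)!}\;\mathcal L_{d-1}^{6\kappa+3}(2E)\,\mathcal L_{d-1}^{6\kappa+4}(2E).$$ 4. The matrix that expresses the vectors $|E_{\kappa,m},\kappa\rangle$ through the Fock states $|n,2\kappa\rangle$, $n<d_\kappa$, is $T=T_2T_1$. Here $T_1$ (from the Fock states to the states $\overline{|n,2\kappa\rangle}$) is triangular with unit diagonal in the lexicographic order of $(\kappa,n)$, so $\det T_1=1$. The matrix $T_2$ is block diagonal, its block $\kappa$ being the matrix $\big(L_n^{6\kappa+3}(2E_{\kappa,m})\big)_{m,n}$ with row $m$ multiplied by $(2E_{\kappa,m})^{3\kappa}e^{-E_{\kappa,m}}$,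 and $$\det\big(L_n^{6\kappa+3}(2E_{\kappa,m})\big)_{m,n}=\prod_{k=0}^{d_\kappa-1}\frac{(-1)^k}{k!\,(6\kappa+3+k)!}\prod_{1\le i<j\le d_\kappa}(2E_{\kappa,j}-2E_{\kappa,i})\neq0 .$$ Consequently $\det T\ne0$. The Fock states $|n,2\kappa\rangle$ ($0\le\kappa\le\lfloor N/6\rfloor$, $0\le n<d_\kappa$) are linearly independent, and the vectors $|E_{\kappa,m},\kappa\rangle$ form a basis of the even sector at cut-off $N$. -/

import Mathlib

open scoped Nat ComplexConjugate

noncomputable section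

namespace SYMQM

/-! ### Laguerre polynomials -/

/-- The generalized Laguerre polynomial `𝓛_n^a(x) = ∑ᵢ (-1)ⁱ (n+a choose n-i) xⁱ / i!`. -/
def laguerre (n a : ℕ) : Polynomial ℝ :=
  ∑ i ∈ Finset.range (n + 1),
    Polynomial.monomial i ((-1 : ℝ) ^ i * ((n + a).choose (n - i) : ℝ) / (i ! : ℝ))

/-- The rescaled (Sonine) polynomial `L_n^a(x) = 𝓛_n^a(x) / Γ(n+a+1)`, where `Γ(n+a+1) = (n+a)!`. -/
def sonine (n a : ℕ) (x : ℝ) : ℝ :=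
  (laguerre n a).eval x / ((n + a)! : ℝ)

/-! ### The bosonic Fock space of eight oscillators -/

/-- Bosonic states with finitely many quanta: polynomials in the eight commuting creation
operators, applied to the vacuum `|0⟩ = 1`. -/
abbrev Fock : Type := MvPolynomial (Fin 8) ℂ

/-- The Fock scalar product, conjugate linear in the first argument: monomials in the creation
operators are orthogonal and `‖∏ (a†_A)^{m_A} |0⟩‖² = ∏ m_A!`. -/
def fockInner (f g : Fock) : ℂ :=
  ∑ m ∈ f.support, ((∏ A, (m A)! : ℕ) : ℂ) * (conj (f.coeff m) * g.coeff m)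

/-- The creation operator `a†_A`. -/
def create (A : Fin 8) : Module.End ℂ Fock :=
  LinearMap.mulLeft ℂ (MvPolynomial.X A)

/-- The annihilation operator `a_A`, with `[a_A, a†_B] = δ_{AB}` and `a_A |0⟩ = 0`. -/
def annihilate (A : Fin 8) : Module.End ℂ Fock :=
  (MvPolynomial.pderiv A).toLinearMap

/-- `T` is a system of generators of `SU(3)` in the fundamental representation: eight Hermitian
traceless `3 × 3` matrices with `tr (T^A T^B) = δ_{AB} / 2`. -/
structure IsSU3Generators (T : Fin 8 → Matrix (Fin 3) (Fin 3) ℂ) : Prop where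
  isHermitian : ∀ A, (T A).IsHermitian
  trace_eq_zero : ∀ A, (T A).trace = 0
  trace_mul : ∀ A B, (T A * T B).trace = if A = B then 1 / 2 else 0

variable (T : Fin 8 → Matrix (Fin 3) (Fin 3) ℂ)

/-- The operator valued matrix `a†_{ij} = ∑_A a†_A T^A_{ij}`. -/
def createMatrix : Matrix (Fin 3) (Fin 3) (Module.End ℂ Fock) :=
  Matrix.of fun i j => ∑ A, T A i j • create A

/-- The operator valued matrix `a_{ij} = ∑_A a_A T^A_{ij}`. -/
def annihilateMatrix : Matrix (Fin 3) (Fin 3) (Module.End ℂ Fock) :=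
  Matrix.of fun i j => ∑ A, T A i j • annihilate A

/-- `H = tr(a†a) + 2 - tr(a†a†)/2 - tr(aa)/2`. -/
def hamiltonian : Module.End ℂ Fock :=
  (createMatrix T * annihilateMatrix T).trace + (2 : ℂ) • 1
    - (1 / 2 : ℂ) • (createMatrix T * createMatrix T).trace
    - (1 / 2 : ℂ) • (annihilateMatrix T * annihilateMatrix T).trace

/-- The projection onto the states with at most `N` quanta. -/
def cutProjection (N : ℕ) : Module.End ℂ Fock :=
  ∑ i ∈ Finset.range (N + 1), MvPolynomial.homogeneousComponent i

/-- The Hamiltonian at cut-off `N`, to be applied to states with at most `N` quanta. -/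
def cutHamiltonian (N : ℕ) : Module.End ℂ Fock :=
  cutProjection N * hamiltonian T

/-- The state `|j,k⟩ = (tr a†a†)^j (tr a†a†a†)^k |0⟩`. -/
def fockState (j k : ℕ) : Fock :=
  ((createMatrix T * createMatrix T).trace ^ j *
    (createMatrix T * createMatrix T * createMatrix T).trace ^ k) 1

/-- The span of the states `|j,2k⟩` with at most `N` quanta: the states at cut-off `N` that are
built with an even number of cubic bricks. -/
def evenSector (N : ℕ) : Submodule ℂ Fock :=
  Submodule.span ℂ {v | ∃ j k : ℕ, 2 * j + 3 * (2 * k) ≤ N ∧ v = fockState T j (2 * k)}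

/-! ### Orthogonalized Fock states and energy eigenstates -/

/-- `gammaEven κ t` is `(-24)^{t-κ} (κ+t)! / ((κ-t)! (2t)!)`, for `t ≤ κ`. -/
def gammaEven (κ t : ℕ) : ℝ :=
  (-24 : ℝ) ^ ((t : ℤ) - (κ : ℤ)) * ((κ + t)! : ℝ) / (((κ - t)! : ℝ) * ((2 * t)! : ℝ))

/-- The orthogonalized Fock state `|n,2κ⟩` with a bar. -/
def barState (n κ : ℕ) : Fock :=
  fockState T n (2 * κ) +
    ∑ t ∈ Finset.Icc 1 κ,
      ((gammaEven κ (κ - t) : ℝ) : ℂ) • fockState T (n + 3 * t) (2 * κ - 2 * t)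

/-- The number `d_κ = ⌊(N - 6κ)/2⌋ + 1` of states in the family `κ` at cut-off `N`, for
`6κ ≤ N`. -/
def dim (N κ : ℕ) : ℕ := (N - 6 * κ) / 2 + 1

/-- The vector `|e,κ⟩ = (2e)^{3κ} exp(-e) ∑_{n < d_κ} L_n^{6κ+3}(2e) |n,2κ⟩` (barred states on the
right). -/
def energyState (N κ : ℕ) (e : ℝ) : Fock :=
  (((2 * e) ^ (3 * κ) * Real.exp (-e) : ℝ) : ℂ) •
    ∑ n ∈ Finset.range (dim N κ), ((sonine n (6 * κ + 3) (2 * e) : ℝ) : ℂ) • barState T n κ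

/-- Labels `(κ, n)` with `κ ≤ ⌊N/6⌋` and `n < d_κ`; they label the Fock states `|n,2κ⟩` with at most
`N` quanta, the barred states, and the energy eigenstates at cut-off `N`. -/
abbrev Label (N : ℕ) : Type := Σ κ : Fin (N / 6 + 1), Fin (dim N κ)

/-- `E κ 0 < E κ 1 < …` are all the real solutions `e` of `L_{d_κ}^{6κ+3}(2e) = 0`, for each
family `κ`. -/
def IsEnergyLevels (N : ℕ) (E : (κ : Fin (N / 6 + 1)) → Fin (dim N κ) → ℝ) : Prop :=
  ∀ κ, StrictMono (E κ) ∧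
    Set.range (E κ) = {e : ℝ | sonine (dim N κ) (6 * (κ : ℕ) + 3) (2 * e) = 0}

/-! ### Transformation matrices -/

/-- The matrix from the Fock states to the barred states. -/
def matrixT₁ (N : ℕ) : Matrix (Label N) (Label N) ℝ :=
  Matrix.of fun i j =>
    if (j.1 : ℕ) ≤ (i.1 : ℕ) ∧ (j.2 : ℕ) = (i.2 : ℕ) + 3 * ((i.1 : ℕ) - (j.1 : ℕ)) then
      gammaEven i.1 j.1
    else 0

/-- The matrix with entries `L_n^{6κ+3}(2 E_m)`. -/
def laguerreMatrix {d : ℕ} (κ : ℕ) (E : Fin d → ℝ) : Matrix (Fin d) (Fin d) ℝ :=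
  Matrix.of fun m n => sonine n (6 * κ + 3) (2 * E m)

/-- The block diagonal matrix from the barred states to the energy eigenstates; each block is a
Laguerre matrix whose rows carry the normalization factors of the eigenstates. -/
def matrixT₂ (N : ℕ) (E : (κ : Fin (N / 6 + 1)) → Fin (dim N κ) → ℝ) :
    Matrix (Label N) (Label N) ℝ :=
  Matrix.blockDiagonal' fun κ =>
    Matrix.diagonal (fun m => (2 * E κ m) ^ (3 * (κ : ℕ)) * Real.exp (-(E κ m))) *
      laguerreMatrix κ (E κ)

end SYMQM

end

open scoped Nat ComplexConjugate

noncomputable section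

namespace SYMQM

/-! ### Recurrence, derivative and roots of the Laguerre polynomials -/

/-! Read states as polynomials in eight variables: `a†_A` is multiplication by `x_A` and `a_A` is
`∂_A`, its adjoint for the Fock scalar product. With `X = ∑ x_A T^A`, put `q = tr X² = |x|²/2` and
`c = tr X³`. Multiplication by `q` has the half Laplacian `Δ/2` as adjoint, and `[Δ/2, q] = 4 +
(degree)`, an sl₂ relation. Hence on the tower `qⁿ h` over a harmonic homogeneous `h` the
Hamiltonian is tridiagonal, with the coefficients of a Laguerre recurrence.

The barred states are such towers: `barState T n κ = qⁿ h_{2κ}` (`barState_eq`), where `h_{k+2} = c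
h_{k+1} - q³ h_k / 24`. Each `h_k` is harmonic because `Δc = 0` and `|∇c|² = (3/4) q²`; both facts
follow from the completeness relation of the generators, and the second one from `2 tr X⁴ = (tr
X²)²` as well. Harmonic polynomials are orthogonal to all multiples of `q`, so norms follow by
moving factors `c` and `q` across the scalar product (`fockInner_harmonic_add`,
`fockInner_quad_pow_harmonic`).

Applied to a truncated Laguerre sum, `H - E` leaves only two boundary terms
(`hamiltonian_sum_barState`). One lies above the cut-off and is projected away; the other carries
the factor `L_d(2E)`, which the quantization condition annihilates.

The Christoffel–Darboux formula does the rest, since its weights `n! (n+a)!` are the barred norms up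
to a constant. Off the diagonal it gives orthogonality within a family, and at a conjugate pair it
shows that the roots are real; its confluent form gives the norms and the simplicity of the roots.
The energy states are therefore nonzero and orthogonal, and there are as many of them as Fock states
whose span contains them, so both families are bases. -/

open Polynomial in
theorem coeff_laguerre (n a i : ℕ) :
    (laguerre n a).coeff i = (-1 : ℝ) ^ i * ((n + a).choose (a + i) : ℝ) / (i ! : ℝ) := by
  rw [laguerre, finsetSum_coeff]
  simp only [coeff_monomial, Finset.sum_ite_eq', Finset.mem_range]
  split_ifs with h
  · rw [← Nat.choose_symm (n := n + a) (k := n - i) (by omega)]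
    congr 4
    omega
  -- Written with `a + i` instead of `n - i`, the binomial vanishes by itself for `i > n`, so the
  -- closed form needs no bound on `i`.
  · rw [Nat.choose_eq_zero_of_lt (by omega)]
    simp

theorem natDegree_laguerre (n a : ℕ) : (laguerre n a).natDegree = n := by
  apply le_antisymm
  · rw [Polynomial.natDegree_le_iff_coeff_eq_zero]
    intro i hi
    rw [coeff_laguerre, Nat.choose_eq_zero_of_lt (by omega)]
    simp
  · apply Polynomial.le_natDegree_of_ne_zero
    rw [coeff_laguerre, add_comm a n, Nat.choose_self]
    positivity

theorem laguerre_ne_zero (n a : ℕ) : laguerre n a ≠ 0 := by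
  intro h
  have := coeff_laguerre n a n
  rw [h, add_comm a n, Nat.choose_self, Polynomial.coeff_zero] at this
  have h2 : (-1 : ℝ) ^ n * ((1 : ℕ) : ℝ) / (n ! : ℝ) ≠ 0 := by positivity
  exact h2 this.symm

/-- Over the reals the absorption identities hold for every `k`, with no truncated subtraction; this
lets the recurrence be checked coefficientwise without cases. -/
theorem cast_choose_mul_succ (m k : ℕ) :
    (m.choose k : ℝ) * (m + 1) = ((m + 1).choose k : ℝ) * (m + 1 - k) := by
  rcases le_or_gt k (m + 1) with h | h
  · have := Nat.choose_mul_succ_eq m k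
    have h2 : ((m + 1 - k : ℕ) : ℝ) = m + 1 - k := by push_cast [Nat.cast_sub h]; ring
    rw [← h2]
    exact_mod_cast this
  · rw [Nat.choose_eq_zero_of_lt h, Nat.choose_eq_zero_of_lt (by omega)]
    simp

theorem cast_choose_succ_right (m k : ℕ) :
    (m.choose (k + 1) : ℝ) * (k + 1) = (m.choose k : ℝ) * (m - k) := by
  rcases le_or_gt k m with h | h
  · have := Nat.choose_succ_right_eq m k
    rw [← Nat.cast_sub h]
    exact_mod_cast this
  · rw [Nat.choose_eq_zero_of_lt h, Nat.choose_eq_zero_of_lt (by omega)]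
    simp

open Polynomial in
theorem laguerre_recurrence (n a : ℕ) :
    (n + 2 : ℝ[X]) * laguerre (n + 2) a =
      ((2 * n + a + 3 : ℝ[X]) - X) * laguerre (n + 1) a - (n + 1 + a : ℝ[X]) * laguerre n a := by
  have e1 : (n + 2 : ℝ[X]) = C (n + 2 : ℝ) := by
    simp only [map_add, map_natCast, map_ofNat]
  have e2 : (2 * n + a + 3 : ℝ[X]) = C (2 * n + a + 3 : ℝ) := by
    simp only [map_add, map_mul, map_natCast, map_ofNat]
  have e3 : (n + 1 + a : ℝ[X]) = C (n + 1 + a : ℝ) := by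
    simp only [map_add, map_natCast, map_one]
  rw [e1, e2, e3, sub_mul]
  ext i
  rcases i with _ | i
  · simp only [coeff_sub, coeff_C_mul, coeff_X_mul_zero, coeff_laguerre, pow_zero,
      Nat.factorial_zero, Nat.cast_one, add_zero, div_one, one_mul]
    have h1 := cast_choose_mul_succ (n + a) a
    have h2 := cast_choose_mul_succ (n + a + 1) a
    rw [show n + 2 + a = n + a + 1 + 1 by ring, show n + 1 + a = n + a + 1 by ring]
    push_cast at h1 h2 ⊢
    linear_combination h1 - h2
  · simp only [coeff_sub, coeff_C_mul, coeff_X_mul, coeff_laguerre, Nat.factorial_succ]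
    have h1 := cast_choose_mul_succ (n + a) (a + i + 1)
    have h2 := cast_choose_succ_right (n + a + 1) (a + i)
    have h3 : ((n + a + 2).choose (a + i + 1) : ℝ) =
        (n + a + 1).choose (a + i) + (n + a + 1).choose (a + i + 1) := by
      exact_mod_cast Nat.choose_succ_succ (n + a + 1) (a + i)
    rw [show n + 2 + a = n + a + 2 by ring, show n + 1 + a = n + a + 1 by ring,
      ← add_assoc a i 1, h3]
    push_cast at h1 h2 ⊢
    have hi : (i ! : ℝ) ≠ 0 := by positivity
    have hi' : (i + 1 : ℝ) ≠ 0 := by positivity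
    field_simp
    rw [pow_succ]
    linear_combination (-1) ^ i * h2 - (-1) ^ i * h1

open Polynomial in
theorem laguerre_zero (a : ℕ) : laguerre 0 a = 1 := by
  simp [laguerre]

open Polynomial in
theorem laguerre_one (a : ℕ) : laguerre 1 a = (a + 1 : ℝ[X]) - X := by
  have e : (a + 1 : ℝ[X]) = C (a + 1 : ℝ) := by simp
  rw [e]
  simp [laguerre, Finset.sum_range_succ, ← C_mul_X_pow_eq_monomial]
  ring

open Polynomial in
theorem derivative_laguerre (n a : ℕ) :
    derivative (laguerre (n + 1) a) = - laguerre n (a + 1) := by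
  ext i
  rw [coeff_derivative, coeff_neg, coeff_laguerre, coeff_laguerre, Nat.factorial_succ,
    show n + 1 + a = n + (a + 1) by ring, show a + (i + 1) = a + 1 + i by ring]
  push_cast
  have hi : (i ! : ℝ) ≠ 0 := by positivity
  have hi' : (i + 1 : ℝ) ≠ 0 := by positivity
  field_simp
  ring

/-- A solution of the three-term recurrence of the rescaled Laguerre polynomials. -/
structure IsSonineSeq {K : Type*} [Field K] (a : ℕ) (x : K) (s : ℕ → K) : Prop where
  one : (a + 1) * s 1 = (a + 1 - x) * s 0
  add_two : ∀ n : ℕ, (n + 2) * (n + a + 2) * s (n + 2) = (2 * n + a + 3 - x) * s (n + 1) - s n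

/-- The field is general because the reality of the roots is proved by evaluating at complex points.
-/
theorem isSonineSeq_aeval {K : Type*} [Field K] [CharZero K] [Algebra ℝ K] (a : ℕ) (x : K) :
    IsSonineSeq a x fun n => Polynomial.aeval x (laguerre n a) / ((n + a)! : K) where
  one := by
    have h : (a + 1 : K) ≠ 0 := by exact_mod_cast Nat.succ_ne_zero a
    have h' : (a ! : K) ≠ 0 := by exact_mod_cast Nat.factorial_ne_zero a
    rw [laguerre_one, laguerre_zero, zero_add, add_comm 1 a, Nat.factorial_succ]
    push_cast
    simp
    field_simp
  add_two n := by
    have h1 : (n + a + 1 : K) ≠ 0 := by exact_mod_cast Nat.succ_ne_zero (n + a)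
    have h2 : (n + a + 2 : K) ≠ 0 := by exact_mod_cast Nat.succ_ne_zero (n + a + 1)
    have h' : ((n + a)! : K) ≠ 0 := by exact_mod_cast Nat.factorial_ne_zero (n + a)
    have h := congrArg (Polynomial.aeval x) (laguerre_recurrence n a)
    simp only [map_mul, map_sub, map_add, map_natCast, map_ofNat, map_one,
      Polynomial.aeval_X] at h
    rw [show n + 2 + a = n + a + 1 + 1 by ring, show n + 1 + a = n + a + 1 by ring,
      Nat.factorial_succ, Nat.factorial_succ]
    push_cast
    rw [show (n + a + 1 + 1 : K) = n + a + 2 by ring]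
    field_simp
    linear_combination h

theorem isSonineSeq_sonine (a : ℕ) (x : ℝ) : IsSonineSeq a x fun n => sonine n a x := by
  simpa [sonine, Polynomial.aeval_def, Polynomial.eval₂_eq_eval_map] using
    isSonineSeq_aeval (K := ℝ) a x

/-- The Christoffel–Darboux formula. -/
theorem IsSonineSeq.christoffel_darboux {K : Type*} [Field K] {a : ℕ} {x y : K} {s t : ℕ → K}
    (hs : IsSonineSeq a x s) (ht : IsSonineSeq a y t) (d : ℕ) :
    (x - y) * ∑ n ∈ Finset.range (d + 1), (n ! : K) * (n + a)! * (s n * t n) =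
      ((d + 1)! : K) * (d + a + 1)! * (s d * t (d + 1) - s (d + 1) * t d) := by
  induction d with
  | zero =>
    have h1 := hs.one
    have h2 := ht.one
    simp only [Finset.range_one, Finset.sum_singleton, zero_add, Nat.factorial_succ,
      Nat.factorial_zero]
    push_cast
    linear_combination (a ! : K) * t 0 * h1 - (a ! : K) * s 0 * h2
  | succ d ih =>
    rw [Finset.sum_range_succ, mul_add, ih]
    have h1 := hs.add_two d
    have h2 := ht.add_two d
    rw [Nat.factorial_succ (d + 1), show d + 1 + a + 1 = (d + a + 1) + 1 by ring,
      Nat.factorial_succ (d + a + 1), show d + 1 + a = d + a + 1 by ring]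
    push_cast
    -- Cross-multiplying the two recurrences by `t` and `s` and subtracting leaves the new term `(x
    -- - y) s t` and a telescoping difference.
    linear_combination ((d + 1)! : K) * (d + a + 1)! * (t (d + 1) * h1 - s (d + 1) * h2)

open Polynomial in
/-- The confluent Christoffel–Darboux formula. -/
theorem sum_sonine_sq (a : ℕ) (x : ℝ) (d : ℕ) :
    ∑ n ∈ Finset.range (d + 1), (n ! : ℝ) * (n + a)! * sonine n a x ^ 2 =
      ((d + 1)! : ℝ) / (d + a)! *
        ((derivative (laguerre d a)).eval x * (laguerre (d + 1) a).eval x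
          - (derivative (laguerre (d + 1) a)).eval x * (laguerre d a).eval x) := by
  have hpos : ∀ n : ℕ, (n ! : ℝ) ≠ 0 := fun n => by positivity
  simp only [sonine]
  induction d with
  | zero =>
    have := hpos a
    simp [laguerre_one, laguerre_zero]
    field_simp
  | succ d ih =>
    rw [Finset.sum_range_succ, ih]
    have h1 := congrArg (eval x) (laguerre_recurrence d a)
    -- Differentiating the recurrence replaces the limit `y → x`: the derivative of its coefficient
    -- `-X` produces the new square.
    have h2 := congrArg (fun p => eval x (derivative p)) (laguerre_recurrence d a)
    simp only [eval_mul, eval_sub, eval_add, eval_natCast, eval_ofNat, eval_one, eval_X,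
      derivative_mul, derivative_sub, derivative_add, derivative_natCast, derivative_ofNat,
      derivative_one, derivative_X, eval_zero] at h1 h2
    rw [Nat.factorial_succ (d + 1), show d + 1 + 1 = d + 2 by ring,
      show d + 1 + a = (d + a) + 1 by ring, Nat.factorial_succ (d + a)]
    have h3 := hpos (d + a)
    have h4 : (d + a + 1 : ℝ) ≠ 0 := by positivity
    push_cast
    field_simp
    linear_combination (-eval x (derivative (laguerre (d + 1) a))) * h1 +
      eval x (laguerre (d + 1) a) * h2

theorem sonine_eq_zero_iff (n a : ℕ) (x : ℝ) :
    sonine n a x = 0 ↔ (laguerre n a).IsRoot x := by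
  have h : ((n + a)! : ℝ) ≠ 0 := by positivity
  simp [sonine, h, Polynomial.IsRoot]

theorem sum_sonine_sq_pos (a : ℕ) (x : ℝ) (d : ℕ) :
    0 < ∑ n ∈ Finset.range (d + 1), (n ! : ℝ) * (n + a)! * sonine n a x ^ 2 := by
  rw [Finset.sum_range_succ']
  have : sonine 0 a x ≠ 0 := by
    rw [Ne, sonine_eq_zero_iff, laguerre_zero]
    simp
  exact add_pos_of_nonneg_of_pos
    (Finset.sum_nonneg fun n _ => mul_nonneg (by positivity) (sq_nonneg _))
    (mul_pos (by positivity) (sq_pos_of_ne_zero this))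

/-- The sum of squares at a zero of the polynomial of the next degree. -/
theorem sum_sonine_sq_of_root (a : ℕ) (x : ℝ) (d : ℕ) (hx : (laguerre (d + 1) a).IsRoot x) :
    ∑ n ∈ Finset.range (d + 1), (n ! : ℝ) * (n + a)! * sonine n a x ^ 2 =
      ((d + 1)! : ℝ) / (d + a)! * ((laguerre d a).eval x * (laguerre d (a + 1)).eval x) := by
  rw [sum_sonine_sq, derivative_laguerre, hx.eq_zero, Polynomial.eval_neg]
  ring

theorem eval_laguerre_pos (n a : ℕ) {x : ℝ} (hx : x ≤ 0) : 0 < (laguerre n a).eval x := by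
  rw [laguerre, Polynomial.eval_finsetSum]
  simp only [Polynomial.eval_monomial]
  have key : ∀ i : ℕ, (-1 : ℝ) ^ i * ((n + a).choose (n - i) : ℝ) / (i ! : ℝ) * x ^ i =
      ((n + a).choose (n - i) : ℝ) / (i ! : ℝ) * (-x) ^ i := by
    intro i
    rw [neg_pow x]
    ring
  simp only [key]
  have hx' : 0 ≤ -x := by linarith
  rw [Finset.sum_range_succ']
  have h0 : (0 : ℝ) < ((n + a).choose (n - 0) : ℝ) := by
    exact_mod_cast Nat.choose_pos (by omega)
  refine add_pos_of_nonneg_of_pos (Finset.sum_nonneg fun i _ => by positivity) ?_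
  simpa using h0

/-- At a complex root `z`, Christoffel–Darboux with `x = z`, `y = conj z` has right side zero, while
its sum is a positive combination of `|𝓛_n(z)|²` with `𝓛_0 = 1`. So `z = conj z`. -/
theorem splits_laguerre (n a : ℕ) : (laguerre n a).Splits := by
  rcases n with _ | d
  · rw [laguerre_zero]
    exact Polynomial.Splits.one
  refine Polynomial.Splits.of_splits_map (algebraMap ℝ ℂ) (IsAlgClosed.splits _) ?_
  intro z hz
  have hz0 : Polynomial.aeval z (laguerre (d + 1) a) = 0 := by
    rw [Polynomial.aeval_def, ← Polynomial.eval_map]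
    exact (Polynomial.mem_roots'.1 hz).2
  have hc : ∀ n, Polynomial.aeval (conj z) (laguerre n a) =
      conj (Polynomial.aeval z (laguerre n a)) := fun n =>
    Polynomial.aeval_conj (laguerre n a) z
  have h := (isSonineSeq_aeval (K := ℂ) a z).christoffel_darboux
    (isSonineSeq_aeval (K := ℂ) a (conj z)) d
  simp only [hc, hz0, map_zero, zero_div, mul_zero, zero_mul, sub_zero] at h
  have hsum : ∑ n ∈ Finset.range (d + 1), (n ! : ℂ) * (n + a)! *
      (Polynomial.aeval z (laguerre n a) / ((n + a)! : ℂ) *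
        (conj (Polynomial.aeval z (laguerre n a)) / ((n + a)! : ℂ))) =
      ((∑ n ∈ Finset.range (d + 1), (n ! : ℝ) / (n + a)! *
        Complex.normSq (Polynomial.aeval z (laguerre n a)) : ℝ) : ℂ) := by
    push_cast
    refine Finset.sum_congr rfl fun n _ => ?_
    have : ((n + a)! : ℂ) ≠ 0 := by exact_mod_cast Nat.factorial_ne_zero _
    rw [Complex.normSq_eq_conj_mul_self]
    field_simp
  have hpos : 0 < ∑ n ∈ Finset.range (d + 1), (n ! : ℝ) / (n + a)! *
        Complex.normSq (Polynomial.aeval z (laguerre n a)) := by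
    rw [Finset.sum_range_succ']
    refine add_pos_of_nonneg_of_pos (Finset.sum_nonneg fun n _ =>
      mul_nonneg (by positivity) (Complex.normSq_nonneg _)) ?_
    rw [laguerre_zero, map_one, map_one]
    positivity
  rw [hsum] at h
  rcases mul_eq_zero.1 h with h | h
  · exact ⟨z.re, Complex.conj_eq_iff_re.1 (sub_eq_zero.1 h).symm⟩
  · exact absurd (Complex.ofReal_eq_zero.1 h) hpos.ne'

theorem card_roots_laguerre (n a : ℕ) : (laguerre n a).roots.card = n := by
  rw [← (splits_laguerre n a).natDegree_eq_card_roots, natDegree_laguerre]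

/-- At a double root the right side of the confluent formula would vanish, but the sum of squares is
positive. -/
theorem nodup_roots_laguerre (n a : ℕ) : (laguerre n a).roots.Nodup := by
  rcases n with _ | d
  · simp [laguerre_zero]
  rw [Multiset.nodup_iff_count_le_one]
  intro x
  rw [Polynomial.count_roots]
  by_contra! h
  have hr := (Polynomial.one_lt_rootMultiplicity_iff_isRoot (laguerre_ne_zero (d + 1) a)).1 h
  have h1 := sum_sonine_sq a x d
  have h2 := sum_sonine_sq_pos a x d
  have h3 := hr.1.eq_zero
  have h4 := hr.2.eq_zero
  rw [h1, h3, h4] at h2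
  simp at h2

theorem pos_of_mem_roots_laguerre {n a : ℕ} {x : ℝ} (hx : x ∈ (laguerre n a).roots) : 0 < x := by
  by_contra! h
  exact (eval_laguerre_pos n a h).ne' (Polynomial.isRoot_of_mem_roots hx)

/-- The determinant of the values of the rescaled Laguerre polynomials. -/
theorem det_laguerreMatrix {d : ℕ} (κ : ℕ) (E : Fin d → ℝ) :
    (laguerreMatrix κ E).det =
      (∏ k : Fin d, (-1 : ℝ) ^ (k : ℕ) /
        (((k : ℕ)! : ℝ) * ((6 * κ + 3 + (k : ℕ))! : ℝ))) *
        ∏ i : Fin d, ∏ j ∈ Finset.Ioi i, (2 * E j - 2 * E i) := by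
  -- The `n`-th polynomial has degree `n`, so the matrix is Vandermonde times a triangular matrix of
  -- coefficients; the leading coefficients give the first product.
  have h := Matrix.eval_matrixOfPolynomials_eq_vandermonde_mul_matrixOfPolynomials
    (fun m => 2 * E m)
    (fun n : Fin d => Polynomial.C (((n + (6 * κ + 3))! : ℝ)⁻¹) * laguerre n (6 * κ + 3))
    (fun n => (Polynomial.natDegree_C_mul_le _ _).trans (natDegree_laguerre _ _).le)
  have h' : laguerreMatrix κ E = Matrix.of fun m n : Fin d =>
      (Polynomial.C (((n + (6 * κ + 3))! : ℝ)⁻¹) * laguerre n (6 * κ + 3)).eval (2 * E m) := by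
    ext m n
    simp [laguerreMatrix, sonine, div_eq_inv_mul]
  rw [h', h, Matrix.det_mul, Matrix.det_vandermonde, mul_comm]
  congr 1
  rw [Matrix.det_of_isUpperTriangular]
  · refine Finset.prod_congr rfl fun k _ => ?_
    rw [Matrix.of_apply, Polynomial.coeff_C_mul, coeff_laguerre, add_comm (6 * κ + 3) (k : ℕ),
      Nat.choose_self]
    push_cast
    field_simp
  · intro i j hij
    rw [Matrix.of_apply, Polynomial.coeff_C_mul, coeff_laguerre, Nat.choose_eq_zero_of_lt]
    · simp
    · have : (j : ℕ) < i := hij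
      omega

theorem det_laguerreMatrix_ne_zero {d : ℕ} (κ : ℕ) {E : Fin d → ℝ} (hE : StrictMono E) :
    (laguerreMatrix κ E).det ≠ 0 := by
  rw [det_laguerreMatrix]
  refine mul_ne_zero (Finset.prod_ne_zero_iff.2 fun k _ => by positivity)
    (Finset.prod_ne_zero_iff.2 fun i _ => Finset.prod_ne_zero_iff.2 fun j hj => ?_)
  have := hE (Finset.mem_Ioi.1 hj)
  linarith

/-! ### The Fock scalar product -/

/-- The definition sums over the support of the first argument; additivity and symmetry need a
common, larger index set. -/
theorem fockInner_eq_sum {f : Fock} {s : Finset (Fin 8 →₀ ℕ)} (hs : f.support ⊆ s) (g : Fock) :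
    fockInner f g = ∑ m ∈ s, ((∏ A, (m A)! : ℕ) : ℂ) * (conj (f.coeff m) * g.coeff m) := by
  refine Finset.sum_subset hs fun m _ hm => ?_
  rw [MvPolynomial.notMem_support_iff.1 hm]
  simp

theorem fockInner_add_left (f f' g : Fock) :
    fockInner (f + f') g = fockInner f g + fockInner f' g := by
  classical
  rw [fockInner_eq_sum MvPolynomial.support_add g,
    fockInner_eq_sum (Finset.subset_union_left (s₂ := f'.support)) g,
    fockInner_eq_sum (Finset.subset_union_right (s₁ := f.support)) g, ← Finset.sum_add_distrib]
  refine Finset.sum_congr rfl fun m _ => ?_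
  rw [MvPolynomial.coeff_add, map_add]
  ring

theorem fockInner_smul_left (c : ℂ) (f g : Fock) :
    fockInner (c • f) g = conj c * fockInner f g := by
  rw [fockInner_eq_sum MvPolynomial.support_smul g, fockInner, Finset.mul_sum]
  refine Finset.sum_congr rfl fun m _ => ?_
  rw [MvPolynomial.coeff_smul, smul_eq_mul, map_mul]
  ring

theorem fockInner_add_right (f g g' : Fock) :
    fockInner f (g + g') = fockInner f g + fockInner f g' := by
  simp only [fockInner, ← Finset.sum_add_distrib, MvPolynomial.coeff_add, mul_add]

theorem fockInner_smul_right (c : ℂ) (f g : Fock) :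
    fockInner f (c • g) = c * fockInner f g := by
  rw [fockInner, fockInner, Finset.mul_sum]
  refine Finset.sum_congr rfl fun m _ => ?_
  rw [MvPolynomial.coeff_smul, smul_eq_mul]
  ring

theorem conj_fockInner (f g : Fock) : conj (fockInner f g) = fockInner g f := by
  classical
  rw [fockInner_eq_sum (Finset.subset_union_left (s₂ := g.support)) g,
    fockInner_eq_sum (Finset.subset_union_right (s₁ := f.support)) f, map_sum]
  refine Finset.sum_congr rfl fun m _ => ?_
  rw [map_mul, map_mul, Complex.conj_conj, Complex.conj_natCast]
  ring

/-- The Fock scalar product as a sesquilinear map. -/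
def fockForm : Fock →ₗ⋆[ℂ] Fock →ₗ[ℂ] ℂ :=
  LinearMap.mk₂'ₛₗ (starRingEnd ℂ) (RingHom.id ℂ) fockInner fockInner_add_left
    fockInner_smul_left fockInner_add_right fockInner_smul_right

theorem fockForm_apply (f g : Fock) : fockForm f g = fockInner f g := rfl

theorem fockInner_sum_left {ι : Type*} (s : Finset ι) (f : ι → Fock) (g : Fock) :
    fockInner (∑ i ∈ s, f i) g = ∑ i ∈ s, fockInner (f i) g := by
  simp only [← fockForm_apply, map_sum, LinearMap.sum_apply]

theorem fockInner_sum_right {ι : Type*} (s : Finset ι) (f : Fock) (g : ι → Fock) :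
    fockInner f (∑ i ∈ s, g i) = ∑ i ∈ s, fockInner f (g i) := by
  simp only [← fockForm_apply, map_sum]

theorem fockInner_sub_left (f f' g : Fock) :
    fockInner (f - f') g = fockInner f g - fockInner f' g := by
  simp only [← fockForm_apply, map_sub, LinearMap.sub_apply]

theorem fockInner_zero_left (g : Fock) : fockInner 0 g = 0 := by
  simp [fockInner]

theorem fockInner_zero_right (f : Fock) : fockInner f 0 = 0 := by
  simp [fockInner]

theorem fockInner_one_one : fockInner 1 1 = 1 := by
  classical
  rw [fockInner_eq_sum (s := {0})]
  · simp
  · rw [← MvPolynomial.C_1]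
    exact MvPolynomial.support_monomial_subset

/-- Creation and annihilation operators are adjoint to each other. -/
theorem fockInner_X_mul (A : Fin 8) (f g : Fock) :
    fockInner (MvPolynomial.X A * f) g = fockInner f (MvPolynomial.pderiv A g) := by
  classical
  rw [fockInner, MvPolynomial.support_X_mul, Finset.sum_map, fockInner]
  refine Finset.sum_congr rfl fun m _ => ?_
  have hp : ∏ B, ((Finsupp.single A 1 + m : Fin 8 →₀ ℕ) B)! = (m A + 1) * ∏ B, (m B)! := by
    rw [← Finset.mul_prod_erase _ _ (Finset.mem_univ A),
      ← Finset.mul_prod_erase _ (fun B => (m B)!) (Finset.mem_univ A), ← mul_assoc]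
    congr 1
    · simp [add_comm 1, Nat.factorial_succ]
    · refine Finset.prod_congr rfl fun B hB => ?_
      simp [(Finset.ne_of_mem_erase hB).symm]
  simp only [addLeftEmbedding_apply]
  rw [MvPolynomial.coeff_X_mul, MvPolynomial.coeff_pderiv, hp, add_comm m]
  push_cast
  ring

/-! ### The Laplace operator and harmonic polynomials -/

/-- Half of the Laplace operator. -/
def halfLaplacian : Module.End ℂ Fock :=
  (1 / 2 : ℂ) • ∑ A, annihilate A * annihilate A

/-- The scalar product of the gradients of two polynomials. -/
def gradInner (f g : Fock) : Fock :=
  ∑ A, MvPolynomial.pderiv A f * MvPolynomial.pderiv A g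

theorem halfLaplacian_apply (f : Fock) :
    halfLaplacian f = (1 / 2 : ℂ) • ∑ A, MvPolynomial.pderiv A (MvPolynomial.pderiv A f) := by
  simp [halfLaplacian, annihilate, LinearMap.sum_apply]

theorem halfLaplacian_mul (f g : Fock) :
    halfLaplacian (f * g) = f * halfLaplacian g + halfLaplacian f * g + gradInner f g := by
  have h : ∀ A : Fin 8, MvPolynomial.pderiv A (MvPolynomial.pderiv A (f * g)) =
      f * MvPolynomial.pderiv A (MvPolynomial.pderiv A g) +
      MvPolynomial.pderiv A (MvPolynomial.pderiv A f) * g +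
      (2 : ℂ) • (MvPolynomial.pderiv A f * MvPolynomial.pderiv A g) := by
    intro A
    simp only [MvPolynomial.pderiv_mul, map_add, two_smul]
    ring
  simp only [halfLaplacian_apply, h, Finset.sum_add_distrib, ← Finset.mul_sum, ← Finset.sum_mul,
    ← Finset.smul_sum, gradInner, smul_add, smul_smul, mul_smul_comm, smul_mul_assoc]
  norm_num

theorem gradInner_mul_right (f g h : Fock) :
    gradInner f (g * h) = gradInner f g * h + g * gradInner f h := by
  simp only [gradInner, MvPolynomial.pderiv_mul, Finset.sum_mul, Finset.mul_sum,
    ← Finset.sum_add_distrib]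
  exact Finset.sum_congr rfl fun A _ => by ring

theorem gradInner_sub_right (f g h : Fock) :
    gradInner f (g - h) = gradInner f g - gradInner f h := by
  simp only [gradInner, map_sub, mul_sub, Finset.sum_sub_distrib]

theorem gradInner_comm (f g : Fock) : gradInner f g = gradInner g f := by
  simp only [gradInner, mul_comm]

theorem gradInner_C_right (f : Fock) (c : ℂ) : gradInner f (MvPolynomial.C c) = 0 := by
  simp [gradInner]

theorem halfLaplacian_C_mul (c : ℂ) (f : Fock) :
    halfLaplacian (MvPolynomial.C c * f) = MvPolynomial.C c * halfLaplacian f := by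
  rw [← MvPolynomial.smul_eq_C_mul, map_smul, MvPolynomial.smul_eq_C_mul]

theorem halfLaplacian_X_mul (A : Fin 8) (f : Fock) :
    halfLaplacian (MvPolynomial.X A * f) =
      MvPolynomial.X A * halfLaplacian f + MvPolynomial.pderiv A f := by
  have h1 : gradInner (MvPolynomial.X A) f = MvPolynomial.pderiv A f := by
    classical
    rw [gradInner, Finset.sum_eq_single A]
    · simp
    · intro B _ hB
      rw [MvPolynomial.pderiv_X_of_ne hB.symm, zero_mul]
    · simp
  have h2 : halfLaplacian (MvPolynomial.X A) = 0 := by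
    classical
    rw [halfLaplacian_apply, Finset.sum_eq_zero, smul_zero]
    intro B _
    rw [MvPolynomial.pderiv_X, Pi.single_apply]
    split_ifs <;> simp
  rw [halfLaplacian_mul, h1, h2]
  ring

theorem pderiv_comm (A B : Fin 8) (f : Fock) :
    MvPolynomial.pderiv A (MvPolynomial.pderiv B f) =
      MvPolynomial.pderiv B (MvPolynomial.pderiv A f) := by
  classical
  have h : ⁅MvPolynomial.pderiv (R := ℂ) A, MvPolynomial.pderiv (R := ℂ) B⁆ = 0 := by
    refine MvPolynomial.derivation_ext fun i => ?_
    rw [Derivation.commutator_apply, MvPolynomial.pderiv_X, MvPolynomial.pderiv_X,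
      Pi.single_apply, Pi.single_apply]
    split_ifs <;> simp
  have h' := congrArg (fun D => D f) h
  simpa [Derivation.commutator_apply, sub_eq_zero] using h'

theorem halfLaplacian_pderiv (A : Fin 8) (f : Fock) :
    halfLaplacian (MvPolynomial.pderiv A f) = MvPolynomial.pderiv A (halfLaplacian f) := by
  have h : ∀ B, MvPolynomial.pderiv B (MvPolynomial.pderiv B (MvPolynomial.pderiv A f)) =
      MvPolynomial.pderiv A (MvPolynomial.pderiv B (MvPolynomial.pderiv B f)) := fun B => by
    rw [pderiv_comm B A, pderiv_comm B A]
  simp only [halfLaplacian_apply, h, map_sum, Derivation.map_smul]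

/-- Third powers of the Laplace operator turn cubic multiplication operators into cubic
differential operators on harmonic polynomials. -/
theorem halfLaplacian_cubed_X_mul {f : Fock} (hf : halfLaplacian f = 0) (A B D : Fin 8) :
    halfLaplacian (halfLaplacian (halfLaplacian
      (MvPolynomial.X A * (MvPolynomial.X B * (MvPolynomial.X D * f))))) =
      6 * MvPolynomial.pderiv A (MvPolynomial.pderiv B (MvPolynomial.pderiv D f)) := by
  -- Each `Δ/2` either turns one factor `x` into the commuting `∂` or reaches `f` and kills it; the
  -- `3!` orders of conversion give the factor 6.
  simp only [halfLaplacian_X_mul, map_add, halfLaplacian_pderiv, hf, map_zero, mul_zero, zero_add,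
    add_zero]
  ring

/-! ### Completeness of the generators -/

/-- The eight generators and the identity form an orthogonal basis of the 3 × 3 matrices for the
trace form. `V` and `W` record this basis and its dual, `none` standing for the identity; the trace
conditions say `V * W = 1`. -/
theorem IsSU3Generators.completeness {T : Fin 8 → Matrix (Fin 3) (Fin 3) ℂ}
    (hT : IsSU3Generators T) (i j k l : Fin 3) :
    ∑ A, T A i j * T A k l =
      (if i = l ∧ j = k then 1 / 2 else 0) - (if i = j ∧ k = l then 1 / 6 else 0) := by
  let V : Matrix (Option (Fin 8)) (Fin 3 × Fin 3) ℂ :=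
    Matrix.of fun o p => o.elim (if p.1 = p.2 then 1 / 3 else 0) fun A => 2 * T A p.1 p.2
  let W : Matrix (Fin 3 × Fin 3) (Option (Fin 8)) ℂ :=
    Matrix.of fun p o => o.elim (if p.1 = p.2 then 1 else 0) fun A => T A p.2 p.1
  have htr : ∀ A, T A 0 0 + T A 1 1 + T A 2 2 = 0 := fun A => by
    have := hT.trace_eq_zero A
    simpa [Matrix.trace, Fin.sum_univ_three] using this
  have h : V * W = 1 := by
    ext a b
    rw [Matrix.mul_apply, Fintype.sum_prod_type, Matrix.one_apply]
    rcases a with _ | A <;> rcases b with _ | B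
    · simp [V, W]
    · simp [V, W, Fin.sum_univ_three]
      linear_combination (1 / 3 : ℂ) * htr B
    · simp [V, W, Fin.sum_univ_three]
      linear_combination (2 : ℂ) * htr A
    · have h2 := hT.trace_mul A B
      simp only [Matrix.trace, Matrix.diag, Matrix.mul_apply] at h2
      simp only [V, W, Matrix.of_apply, Option.elim, mul_assoc, ← Finset.mul_sum, h2,
        Option.some.injEq]
      split_ifs <;> norm_num
  -- Both index types have nine elements, so the left inverse is also a right inverse, and `W * V =
  -- 1` is completeness.
  have h' := (Matrix.mul_eq_one_comm_of_card_eq _ _ _ (by simp)).1 h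
  have h2 := congrFun (congrFun h' (j, i)) (k, l)
  rw [Matrix.mul_apply, Fintype.sum_option, Matrix.one_apply] at h2
  simp only [V, W, Matrix.of_apply, Option.elim, Prod.mk.injEq] at h2
  have h3 : ∑ A, T A i j * T A k l = (1 / 2 : ℂ) * ∑ A, T A i j * (2 * T A k l) := by
    rw [Finset.mul_sum]
    exact Finset.sum_congr rfl fun A _ => by ring
  rw [h3, eq_sub_of_add_eq' h2]
  by_cases e1 : i = l <;> by_cases e2 : j = k <;> by_cases e3 : i = j <;> by_cases e4 : k = l <;>
    simp [e1, e2, e3, e4, eq_comm] <;> (try grind)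

/-! ### The quadratic and the cubic invariant -/

/-- The matrix `S` with entries multiplied by `r`. -/
def tensorMatrix {R : Type*} [Ring R] [Algebra ℂ R] (S : Matrix (Fin 3) (Fin 3) ℂ) (r : R) :
    Matrix (Fin 3) (Fin 3) R :=
  S.map fun z => z • r

theorem tensorMatrix_mul {R : Type*} [Ring R] [Algebra ℂ R] (S S' : Matrix (Fin 3) (Fin 3) ℂ)
    (r r' : R) : tensorMatrix S r * tensorMatrix S' r' = tensorMatrix (S * S') (r * r') := by
  ext i j
  simp [tensorMatrix, Matrix.mul_apply, Finset.sum_smul, smul_smul, mul_comm (S' _ _)]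

theorem trace_tensorMatrix {R : Type*} [Ring R] [Algebra ℂ R] (S : Matrix (Fin 3) (Fin 3) ℂ)
    (r : R) : (tensorMatrix S r).trace = S.trace • r := by
  simp [tensorMatrix, Matrix.trace, Finset.sum_smul]

theorem of_sum_smul_eq {R : Type*} [Ring R] [Algebra ℂ R]
    (T : Fin 8 → Matrix (Fin 3) (Fin 3) ℂ) (u : Fin 8 → R) :
    (Matrix.of fun i j => ∑ A, T A i j • u A) = ∑ A, tensorMatrix (T A) (u A) := by
  ext i j
  simp [tensorMatrix, Matrix.sum_apply]

/-- `R` may be noncommutative, so that the same lemma serves polynomials and the operator traces in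
the Hamiltonian. -/
theorem trace_mul_of_sum_smul {R : Type*} [Ring R] [Algebra ℂ R]
    {T : Fin 8 → Matrix (Fin 3) (Fin 3) ℂ} (hT : IsSU3Generators T) (u v : Fin 8 → R) :
    ((Matrix.of fun i j => ∑ A, T A i j • u A) *
      (Matrix.of fun i j => ∑ A, T A i j • v A)).trace = (1 / 2 : ℂ) • ∑ A, u A * v A := by
  rw [of_sum_smul_eq, of_sum_smul_eq, Finset.sum_mul_sum, Matrix.trace_sum, Finset.smul_sum]
  refine Finset.sum_congr rfl fun A _ => ?_
  rw [Matrix.trace_sum, Finset.sum_eq_single A]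
  · rw [tensorMatrix_mul, trace_tensorMatrix, hT.trace_mul, if_pos rfl]
  · intro B _ hB
    rw [tensorMatrix_mul, trace_tensorMatrix, hT.trace_mul, if_neg hB.symm, zero_smul]
  · simp

variable (T : Fin 8 → Matrix (Fin 3) (Fin 3) ℂ)

/-- The matrix `∑_A x_A T^A` of linear forms. -/
def fieldMatrix : Matrix (Fin 3) (Fin 3) Fock :=
  Matrix.of fun i j => ∑ A, T A i j • (MvPolynomial.X A : Fock)

/-- The quadratic invariant. -/
def quad : Fock := (fieldMatrix T * fieldMatrix T).trace

/-- The cubic invariant. -/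
def cub : Fock := (fieldMatrix T * fieldMatrix T * fieldMatrix T).trace

theorem createMatrix_eq : createMatrix T = (fieldMatrix T).map (Algebra.lmul ℂ Fock) := by
  ext i j : 2
  simp only [createMatrix, fieldMatrix, Matrix.of_apply, Matrix.map_apply, map_sum, map_smul]
  rfl

theorem trace_createMatrix_sq :
    (createMatrix T * createMatrix T).trace = Algebra.lmul ℂ Fock (quad T) := by
  rw [createMatrix_eq, ← Matrix.map_mul, quad, AddMonoidHom.map_trace]

theorem trace_createMatrix_cubed :
    (createMatrix T * createMatrix T * createMatrix T).trace = Algebra.lmul ℂ Fock (cub T) := by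
  rw [createMatrix_eq, ← Matrix.map_mul, ← Matrix.map_mul, cub, AddMonoidHom.map_trace]

theorem fockState_eq (j k : ℕ) : fockState T j k = quad T ^ j * cub T ^ k := by
  rw [fockState, trace_createMatrix_sq, trace_createMatrix_cubed, ← map_pow, ← map_pow, ← map_mul]
  simp

theorem cub_eq_sum : cub T = ∑ A, ∑ B, ∑ D, (T A * T B * T D).trace •
    ((MvPolynomial.X A * MvPolynomial.X B * MvPolynomial.X D : Fock)) := by
  rw [cub, fieldMatrix, of_sum_smul_eq, Finset.sum_mul_sum, Finset.sum_mul, Matrix.trace_sum]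
  refine Finset.sum_congr rfl fun A _ => ?_
  rw [Finset.sum_mul, Matrix.trace_sum]
  refine Finset.sum_congr rfl fun B _ => ?_
  rw [Finset.mul_sum, Matrix.trace_sum]
  refine Finset.sum_congr rfl fun D _ => ?_
  rw [tensorMatrix_mul, tensorMatrix_mul, trace_tensorMatrix]

theorem pderiv_fieldMatrix (A : Fin 8) (i j : Fin 3) :
    MvPolynomial.pderiv A (fieldMatrix T i j) = MvPolynomial.C (T A i j) := by
  classical
  rw [fieldMatrix, Matrix.of_apply, map_sum, Finset.sum_eq_single A]
  · rw [Derivation.map_smul, MvPolynomial.pderiv_X_self, MvPolynomial.smul_eq_C_mul, mul_one]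
  · intro B _ hB
    rw [Derivation.map_smul, MvPolynomial.pderiv_X_of_ne hB, smul_zero]
  · simp

theorem pderiv_cub (A : Fin 8) : MvPolynomial.pderiv A (cub T) =
    3 * ((T A).map MvPolynomial.C * (fieldMatrix T * fieldMatrix T)).trace := by
  simp only [cub, Matrix.trace, Matrix.diag, Matrix.mul_apply, Fin.sum_univ_three, map_add,
    MvPolynomial.pderiv_mul, pderiv_fieldMatrix, Matrix.map_apply]
  ring

variable {T}

theorem quad_eq_sum (hT : IsSU3Generators T) :
    quad T = (1 / 2 : ℂ) • ∑ A, (MvPolynomial.X A * MvPolynomial.X A : Fock) :=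
  trace_mul_of_sum_smul hT _ _

theorem trace_fieldMatrix (hT : IsSU3Generators T) : (fieldMatrix T).trace = 0 := by
  rw [fieldMatrix, of_sum_smul_eq, Matrix.trace_sum]
  refine Finset.sum_eq_zero fun A _ => ?_
  rw [trace_tensorMatrix, hT.trace_eq_zero, zero_smul]

theorem isHomogeneous_fieldMatrix (i j : Fin 3) : (fieldMatrix T i j).IsHomogeneous 1 := by
  rw [fieldMatrix, Matrix.of_apply]
  refine MvPolynomial.IsHomogeneous.sum _ _ _ fun A _ => ?_
  rw [MvPolynomial.smul_eq_C_mul]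
  simpa using (MvPolynomial.isHomogeneous_C (Fin 8) (T A i j)).mul
    (MvPolynomial.isHomogeneous_X ℂ A)

theorem isHomogeneous_quad : (quad T).IsHomogeneous 2 := by
  simp only [quad, Matrix.trace, Matrix.diag, Matrix.mul_apply]
  exact MvPolynomial.IsHomogeneous.sum _ _ _ fun i _ => MvPolynomial.IsHomogeneous.sum _ _ _
    fun j _ => (isHomogeneous_fieldMatrix i j).mul (isHomogeneous_fieldMatrix j i)

theorem isHomogeneous_cub : (cub T).IsHomogeneous 3 := by
  simp only [cub, Matrix.trace, Matrix.diag, Matrix.mul_apply]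
  exact MvPolynomial.IsHomogeneous.sum _ _ _ fun i _ => MvPolynomial.IsHomogeneous.sum _ _ _
    fun j _ => (MvPolynomial.IsHomogeneous.sum _ _ _ fun k _ =>
      (isHomogeneous_fieldMatrix i k).mul (isHomogeneous_fieldMatrix k j)).mul
        (isHomogeneous_fieldMatrix j i)

theorem gradInner_quad (hT : IsSU3Generators T) (f : Fock) :
    gradInner (quad T) f = ∑ A, MvPolynomial.X A * MvPolynomial.pderiv A f := by
  classical
  refine Finset.sum_congr rfl fun A _ => ?_
  congr 1
  rw [quad_eq_sum hT, Derivation.map_smul, map_sum, Finset.sum_eq_single A]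
  · rw [MvPolynomial.pderiv_mul, MvPolynomial.pderiv_X_self, one_mul, mul_one, ← two_smul ℂ,
      smul_smul]
    norm_num
  · intro B _ hB
    rw [MvPolynomial.pderiv_mul, MvPolynomial.pderiv_X_of_ne hB]
    ring
  · simp

theorem gradInner_quad_of_isHomogeneous (hT : IsSU3Generators T) {f : Fock} {n : ℕ}
    (hf : f.IsHomogeneous n) : gradInner (quad T) f = n * f := by
  rw [gradInner_quad hT, hf.sum_X_mul_pderiv, nsmul_eq_mul]

theorem halfLaplacian_quad (hT : IsSU3Generators T) : halfLaplacian (quad T) = 4 := by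
  rw [quad_eq_sum hT, map_smul, map_sum]
  have h : ∀ A : Fin 8, halfLaplacian (MvPolynomial.X A * MvPolynomial.X A) = 1 := by
    intro A
    have h0 : halfLaplacian (MvPolynomial.X A) = 0 := by
      have := halfLaplacian_X_mul A 1
      have h1 : halfLaplacian 1 = 0 := by simp [halfLaplacian_apply]
      rw [h1, mul_one] at this
      simpa using this
    rw [halfLaplacian_X_mul, h0]
    simp
  simp only [h, Finset.sum_const, Finset.card_univ, Fintype.card_fin]
  rw [MvPolynomial.smul_eq_C_mul]
  have : (MvPolynomial.C (1 / 2 : ℂ) : Fock) * 2 = 1 := by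
    rw [← map_ofNat MvPolynomial.C 2, ← map_mul]
    norm_num
  simp only [nsmul_eq_mul]
  push_cast
  linear_combination 4 * this

theorem sum_trace_mul_trace (hT : IsSU3Generators T) (S : Matrix (Fin 3) (Fin 3) Fock) :
    ∑ A, ((T A).map MvPolynomial.C * S).trace * ((T A).map MvPolynomial.C * S).trace =
      MvPolynomial.C (1 / 2) * (S * S).trace - MvPolynomial.C (1 / 6) * (S.trace * S.trace) := by
  have h : ∑ A, ((T A).map MvPolynomial.C * S).trace * ((T A).map MvPolynomial.C * S).trace =
      ∑ i, ∑ j, ∑ k, ∑ l, MvPolynomial.C (∑ A, T A i j * T A k l) * (S j i * S l k) := by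
    have ht : ∀ A, ((T A).map MvPolynomial.C * S).trace =
        ∑ p : Fin 3 × Fin 3, MvPolynomial.C (T A p.1 p.2) * S p.2 p.1 := fun A => by
      simp only [Matrix.trace, Matrix.diag, Matrix.mul_apply, Matrix.map_apply,
        Fintype.sum_prod_type]
    have hr : ∑ i, ∑ j, ∑ k, ∑ l, MvPolynomial.C (∑ A, T A i j * T A k l) * (S j i * S l k) =
        ∑ p : Fin 3 × Fin 3, ∑ q : Fin 3 × Fin 3,
          MvPolynomial.C (∑ A, T A p.1 p.2 * T A q.1 q.2) * (S p.2 p.1 * S q.2 q.1) := by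
      simp only [Fintype.sum_prod_type]
    rw [hr]
    simp only [ht, Finset.sum_mul_sum]
    rw [Finset.sum_comm]
    refine Finset.sum_congr rfl fun p _ => ?_
    rw [Finset.sum_comm]
    refine Finset.sum_congr rfl fun q _ => ?_
    rw [map_sum, Finset.sum_mul]
    exact Finset.sum_congr rfl fun A _ => by rw [map_mul]; ring
  rw [h]
  simp only [hT.completeness, Matrix.trace, Matrix.diag, Matrix.mul_apply, Fin.sum_univ_three]
  simp
  ring

/-- Newton's identity for power sums: only three eigenvalues, with sum zero, are present. -/
theorem two_mul_trace_pow_four {R : Type*} [CommRing R] (M : Matrix (Fin 3) (Fin 3) R)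
    (hM : M.trace = 0) : 2 * (M * M * (M * M)).trace = (M * M).trace * (M * M).trace := by
  have h : M 2 2 = - M 0 0 - M 1 1 := by
    simp only [Matrix.trace, Matrix.diag, Fin.sum_univ_three] at hM
    linear_combination hM
  simp only [Matrix.trace, Matrix.diag, Matrix.mul_apply, Fin.sum_univ_three, h]
  ring

/-- Since `∂_A c = 3 tr(T^A X²)`, completeness gives `9 (tr X⁴ / 2 - q² / 6)`, which equals `9 (1/4
- 1/6) q²`. -/
theorem gradInner_cub_cub (hT : IsSU3Generators T) :
    gradInner (cub T) (cub T) = MvPolynomial.C (3 / 4) * quad T ^ 2 := by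
  have h : ∀ A, MvPolynomial.pderiv A (cub T) * MvPolynomial.pderiv A (cub T) =
      9 * (((T A).map MvPolynomial.C * (fieldMatrix T * fieldMatrix T)).trace *
        ((T A).map MvPolynomial.C * (fieldMatrix T * fieldMatrix T)).trace) := fun A => by
    rw [pderiv_cub]
    ring
  have h4 := two_mul_trace_pow_four (fieldMatrix T) (trace_fieldMatrix hT)
  simp only [gradInner, h, ← Finset.mul_sum, sum_trace_mul_trace hT]
  rw [quad]
  have e1 : (MvPolynomial.C (1 / 2 : ℂ) : Fock) = MvPolynomial.C (1 / 12) * 6 := by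
    rw [← map_ofNat MvPolynomial.C 6, ← map_mul]; norm_num
  have e2 : (MvPolynomial.C (1 / 6 : ℂ) : Fock) = MvPolynomial.C (1 / 12) * 2 := by
    rw [← map_ofNat MvPolynomial.C 2, ← map_mul]; norm_num
  have e3 : (MvPolynomial.C (3 / 4 : ℂ) : Fock) = MvPolynomial.C (1 / 12) * 9 := by
    rw [← map_ofNat MvPolynomial.C 9, ← map_mul]; norm_num
  rw [e1, e2, e3]
  linear_combination 27 * MvPolynomial.C (1 / 12) * h4

/-- The quadratic Casimir `∑ T^A T^A = 4/3` is a scalar, so the result is a multiple of `tr X = 0`.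
-/
theorem halfLaplacian_cub (hT : IsSU3Generators T) : halfLaplacian (cub T) = 0 := by
  have h : ∀ A, MvPolynomial.pderiv A (MvPolynomial.pderiv A (cub T)) =
      6 * ((T A * T A).map MvPolynomial.C * fieldMatrix T).trace := fun A => by
    have h3 : MvPolynomial.pderiv A (3 : Fock) = 0 := by
      rw [← map_ofNat MvPolynomial.C 3, MvPolynomial.pderiv_C]
    rw [pderiv_cub, Matrix.map_mul]
    simp only [Matrix.trace, Matrix.diag, Matrix.mul_apply, Fin.sum_univ_three, map_add,
      MvPolynomial.pderiv_mul, pderiv_fieldMatrix, Matrix.map_apply, MvPolynomial.pderiv_C,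
      h3]
    ring
  have h2 : ∑ A, T A * T A = (4 / 3 : ℂ) • 1 := by
    ext i l
    simp only [Matrix.sum_apply, Matrix.mul_apply]
    rw [Finset.sum_comm]
    simp only [hT.completeness, Matrix.smul_apply, Matrix.one_apply, Fin.sum_univ_three]
    fin_cases i <;> fin_cases l <;> simp <;> norm_num
  have h3 : ∑ A, ((T A * T A).map MvPolynomial.C * fieldMatrix T).trace =
      ((∑ A, T A * T A).map MvPolynomial.C * fieldMatrix T).trace := by
    rw [← Matrix.trace_sum, ← Finset.sum_mul]
    congr 2
    ext i j : 2
    simp only [Matrix.sum_apply, Matrix.map_apply, map_sum]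
  have h4 : (((4 / 3 : ℂ) • (1 : Matrix (Fin 3) (Fin 3) ℂ)).map MvPolynomial.C *
      fieldMatrix T).trace = MvPolynomial.C (4 / 3) * (fieldMatrix T).trace := by
    simp [Matrix.trace, Matrix.mul_apply, Fin.sum_univ_three, Matrix.one_apply]
    ring
  rw [halfLaplacian_apply]
  simp only [h, ← Finset.mul_sum]
  rw [h3, h2, h4, trace_fieldMatrix hT]
  simp

/-! ### Adjoints of the invariants and the Hamiltonian -/

theorem fockInner_quad_mul (hT : IsSU3Generators T) (f g : Fock) :
    fockInner (quad T * f) g = fockInner f (halfLaplacian g) := by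
  rw [quad_eq_sum hT, smul_mul_assoc, fockInner_smul_left, Finset.sum_mul, fockInner_sum_left,
    halfLaplacian_apply, fockInner_smul_right, fockInner_sum_right]
  simp only [mul_assoc, fockInner_X_mul, map_div₀, map_one, map_ofNat]

/-- The cubic differential operator adjoint to the multiplication by the cubic invariant. -/
def cubAdjoint (T : Fin 8 → Matrix (Fin 3) (Fin 3) ℂ) (f : Fock) : Fock :=
  ∑ A, ∑ B, ∑ D, (T A * T B * T D).trace •
    MvPolynomial.pderiv A (MvPolynomial.pderiv B (MvPolynomial.pderiv D f))

theorem cub_mul_eq_sum (f : Fock) : cub T * f = ∑ A, ∑ B, ∑ D, (T A * T B * T D).trace •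
    (MvPolynomial.X A * (MvPolynomial.X B * (MvPolynomial.X D * f))) := by
  simp only [cub_eq_sum, Finset.sum_mul, smul_mul_assoc, mul_assoc]

theorem fockInner_cub_mul (hT : IsSU3Generators T) (f g : Fock) :
    fockInner (cub T * f) g = fockInner f (cubAdjoint T g) := by
  have hc : ∀ A B D, conj (T A * T B * T D).trace = (T D * T B * T A).trace := fun A B D => by
    rw [starRingEnd_apply, ← Matrix.trace_conjTranspose, Matrix.conjTranspose_mul,
      Matrix.conjTranspose_mul, (hT.isHermitian A).eq, (hT.isHermitian B).eq,
      (hT.isHermitian D).eq, mul_assoc]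
  rw [cub_mul_eq_sum]
  simp only [cubAdjoint, fockInner_sum_left, fockInner_sum_right, fockInner_smul_left,
    fockInner_smul_right, fockInner_X_mul, hc]
  -- Conjugating the trace and moving the three factors across both reverse the order of the
  -- indices, so exchanging `A` and `D` restores it.
  rw [Finset.sum_congr rfl fun A _ => Finset.sum_comm, Finset.sum_comm]
  refine Finset.sum_congr rfl fun D _ => ?_
  exact Finset.sum_comm

theorem halfLaplacian_cubed_cub_mul {f : Fock} (hf : halfLaplacian f = 0) :
    halfLaplacian (halfLaplacian (halfLaplacian (cub T * f))) = 6 * cubAdjoint T f := by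
  rw [cub_mul_eq_sum]
  simp only [map_sum, map_smul, halfLaplacian_cubed_X_mul hf, cubAdjoint, Finset.mul_sum,
    mul_smul_comm]

theorem hamiltonian_apply (hT : IsSU3Generators T) (f : Fock) :
    hamiltonian T f = (1 / 2 : ℂ) • gradInner (quad T) f + (2 : ℂ) • f
      - (1 / 2 : ℂ) • (quad T * f) - (1 / 2 : ℂ) • halfLaplacian f := by
  have h1 : (createMatrix T * annihilateMatrix T).trace =
      (1 / 2 : ℂ) • ∑ A, create A * annihilate A := trace_mul_of_sum_smul hT _ _
  have h2 : (annihilateMatrix T * annihilateMatrix T).trace = halfLaplacian :=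
    trace_mul_of_sum_smul hT _ _
  rw [hamiltonian, h1, h2, trace_createMatrix_sq, gradInner_quad hT]
  simp [LinearMap.sum_apply, create, annihilate]

/-! ### Invariant harmonic polynomials -/

/-- The invariant harmonic polynomial of degree `3 k`. -/
def harmonic (T : Fin 8 → Matrix (Fin 3) (Fin 3) ℂ) : ℕ → Fock
  | 0 => 1
  | 1 => cub T
  | k + 2 => cub T * harmonic T (k + 1) - MvPolynomial.C (1 / 24) * quad T ^ 3 * harmonic T k

theorem isHomogeneous_harmonic (k : ℕ) : (harmonic T k).IsHomogeneous (3 * k) := by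
  induction k using Nat.twoStepInduction with
  | zero => exact MvPolynomial.isHomogeneous_one _ _
  | one => exact isHomogeneous_cub
  | more k h0 h1 =>
    rw [harmonic]
    refine MvPolynomial.IsHomogeneous.sub ?_ ?_
    · have h := (isHomogeneous_cub (T := T)).mul h1
      rwa [show 3 + 3 * (k + 1) = 3 * (k + 2) by ring] at h
    · have h := ((MvPolynomial.isHomogeneous_C (Fin 8) (1 / 24 : ℂ)).mul
        ((isHomogeneous_quad (T := T)).pow 3)).mul h0
      rwa [show 0 + 2 * 3 + 3 * k = 3 * (k + 2) by ring] at h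

theorem isHomogeneous_quad_pow_mul_harmonic (n k : ℕ) :
    (quad T ^ n * harmonic T k).IsHomogeneous (2 * n + 3 * k) :=
  (isHomogeneous_quad.pow n).mul (isHomogeneous_harmonic k)

theorem gradInner_cub_quad (hT : IsSU3Generators T) : gradInner (cub T) (quad T) = 3 * cub T := by
  rw [gradInner_comm, gradInner_quad_of_isHomogeneous hT isHomogeneous_cub]
  norm_num

/-- This is the cross term of the half Laplacian of `c h_{k+1}`, and it must cancel that of `q³ h_k
/ 24`. The case `k = 0` fixes the constant: `3/4 = 18/24`. -/
theorem gradInner_cub_harmonic (hT : IsSU3Generators T) (k : ℕ) :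
    gradInner (cub T) (harmonic T (k + 1)) =
      MvPolynomial.C (1 / 24) * 9 * (k + 2 : Fock) * quad T ^ 2 * harmonic T k := by
  have h34 : (MvPolynomial.C (3 / 4 : ℂ) : Fock) = MvPolynomial.C (1 / 24) * 18 := by
    rw [← map_ofNat MvPolynomial.C 18, ← map_mul]
    norm_num
  have h1 : gradInner (cub T) (quad T ^ 3) = 9 * quad T ^ 2 * cub T := by
    rw [pow_succ, pow_two, gradInner_mul_right, gradInner_mul_right, gradInner_cub_quad hT]
    ring
  have hc := gradInner_cub_cub hT
  rw [h34] at hc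
  have key : ∀ f : Fock, gradInner (cub T) (MvPolynomial.C (1 / 24) * quad T ^ 3 * f) =
      MvPolynomial.C (1 / 24) * (9 * quad T ^ 2 * cub T * f +
        quad T ^ 3 * gradInner (cub T) f) := fun f => by
    rw [mul_assoc, gradInner_mul_right, gradInner_C_right, gradInner_mul_right, h1]
    ring
  induction k using Nat.twoStepInduction with
  | zero =>
    simp only [harmonic]
    rw [hc]
    push_cast
    ring
  | one =>
    have h0 : gradInner (cub T) (1 : Fock) = 0 := by
      rw [← MvPolynomial.C_1, gradInner_C_right]
    simp only [harmonic]
    rw [gradInner_sub_right, key, gradInner_mul_right, hc, h0]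
    push_cast
    ring
  | more k h0 h1 =>
    rw [harmonic, gradInner_sub_right, key, gradInner_mul_right, hc, h1, h0]
    rw [show harmonic T (k + 1 + 1) = cub T * harmonic T (k + 1) -
      MvPolynomial.C (1 / 24) * quad T ^ 3 * harmonic T k from rfl]
    push_cast
    ring

/-- Commuting `Δ/2` through one factor `q` costs 4 plus the degree to its right; the sum of `4 + 2j
+ e` over `j ≤ n` is the factor. -/
theorem halfLaplacian_quad_pow_mul (hT : IsSU3Generators T) {f : Fock} {e : ℕ}
    (hf : f.IsHomogeneous e) (h0 : halfLaplacian f = 0) (n : ℕ) :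
    halfLaplacian (quad T ^ (n + 1) * f) = (n + 1) * (n + 4 + e) * (quad T ^ n * f) := by
  induction n with
  | zero =>
    rw [zero_add, pow_one, pow_zero, one_mul, halfLaplacian_mul, h0, halfLaplacian_quad hT,
      gradInner_quad_of_isHomogeneous hT hf]
    push_cast
    ring
  | succ n ih =>
    rw [pow_succ' _ (n + 1), mul_assoc, halfLaplacian_mul, ih, halfLaplacian_quad hT,
      gradInner_quad_of_isHomogeneous hT ((isHomogeneous_quad.pow (n + 1)).mul hf)]
    push_cast
    ring

theorem halfLaplacian_harmonic (hT : IsSU3Generators T) (k : ℕ) :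
    halfLaplacian (harmonic T k) = 0 := by
  induction k using Nat.twoStepInduction with
  | zero => simp [harmonic, halfLaplacian_apply]
  | one => exact halfLaplacian_cub hT
  | more k h0 h1 =>
    rw [harmonic, map_sub, halfLaplacian_mul, h1, halfLaplacian_cub hT,
      gradInner_cub_harmonic hT, mul_assoc (MvPolynomial.C (1 / 24)) _ (harmonic T k),
      halfLaplacian_C_mul,
      halfLaplacian_quad_pow_mul hT (isHomogeneous_harmonic k) h0]
    push_cast
    ring

theorem halfLaplacian_quad_pow_mul_harmonic (hT : IsSU3Generators T) (n k : ℕ) :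
    halfLaplacian (quad T ^ (n + 1) * harmonic T k) =
      ((n + 1) * (n + 4 + 3 * k) : ℂ) • (quad T ^ n * harmonic T k) := by
  rw [halfLaplacian_quad_pow_mul hT (isHomogeneous_harmonic k) (halfLaplacian_harmonic hT k),
    MvPolynomial.smul_eq_C_mul]
  congr 1
  push_cast
  simp only [map_mul, map_add, map_natCast, map_ofNat, map_one]

theorem cub_mul_harmonic (k : ℕ) : cub T * harmonic T (k + 1) =
    harmonic T (k + 2) + (1 / 24 : ℂ) • (quad T ^ 3 * harmonic T k) := by
  rw [harmonic, MvPolynomial.smul_eq_C_mul]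
  ring

/-- On harmonic `f` the adjoint of `c` is one sixth of `(Δ/2)³(c f)`. For `f = h_{k+1}` the part
`h_{k+2}` dies and `q³ h_k / 24` is lowered three times. -/
theorem cubAdjoint_harmonic (hT : IsSU3Generators T) (k : ℕ) :
    cubAdjoint T (harmonic T (k + 1)) =
      ((3 * k + 4) * (3 * k + 5) * (3 * k + 6) / 24 : ℂ) • harmonic T k := by
  have h := halfLaplacian_cubed_cub_mul (T := T) (halfLaplacian_harmonic hT (k + 1))
  rw [cub_mul_harmonic] at h
  have h1 := halfLaplacian_quad_pow_mul_harmonic hT 2 k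
  have h2 := halfLaplacian_quad_pow_mul_harmonic hT 1 k
  have h3 := halfLaplacian_quad_pow_mul_harmonic hT 0 k
  norm_num only [zero_add, pow_zero, one_mul] at h1 h2 h3
  simp only [map_add, map_smul, halfLaplacian_harmonic hT, zero_add, h1, h2, h3,
    smul_smul] at h
  rw [← map_ofNat MvPolynomial.C 6, ← MvPolynomial.smul_eq_C_mul] at h
  have h6 := congrArg (fun v => (1 / 6 : ℂ) • v) h
  simp only [smul_smul] at h6
  norm_num at h6
  rw [← h6]
  congr 1
  ring

theorem cubAdjoint_one : cubAdjoint T 1 = 0 := by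
  simp [cubAdjoint]

theorem fockInner_quad_mul_harmonic (hT : IsSU3Generators T) (f : Fock) (k : ℕ) :
    fockInner (quad T * f) (harmonic T k) = 0 := by
  rw [fockInner_quad_mul hT, halfLaplacian_harmonic hT, fockInner_zero_right]

/-- Against a harmonic polynomial, `h_{k+1}` may be replaced by `c h_k`, and the adjoint of `c` then
lowers the other index. The form `a + c` lets both indices descend together; at the bottom `1/6 · 3!
= 1`. -/
theorem fockInner_harmonic_add (hT : IsSU3Generators T) (a c : ℕ) :
    fockInner (harmonic T (a + c)) (harmonic T a) =
      if c = 0 then (1 / 6 : ℂ) * (1 / 24 ^ a) * ((3 * a + 3)! : ℂ) else 0 := by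
  have hq : ∀ f k, fockInner (MvPolynomial.C (1 / 24) * quad T ^ 3 * f) (harmonic T k) = 0 :=
    fun f k => by
      rw [show MvPolynomial.C (1 / 24) * quad T ^ 3 * f =
        quad T * (MvPolynomial.C (1 / 24) * quad T ^ 2 * f) by ring]
      exact fockInner_quad_mul_harmonic hT _ k
  have hstep : ∀ k l, fockInner (harmonic T (k + 1)) (harmonic T l) =
      fockInner (harmonic T k) (cubAdjoint T (harmonic T l)) := by
    intro k l
    rw [← fockInner_cub_mul hT]
    rcases k with _ | k
    · simp [harmonic]
    · rw [harmonic, fockInner_sub_left, hq, sub_zero]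
  induction a with
  | zero =>
    rcases c with _ | c
    · simp only [harmonic, fockInner_one_one]
      norm_num [Nat.factorial]
    · rw [zero_add, hstep, show harmonic T 0 = 1 from rfl, cubAdjoint_one, fockInner_zero_right]
      simp
  | succ a ih =>
    rw [show a + 1 + c = a + c + 1 by ring, hstep, cubAdjoint_harmonic hT, fockInner_smul_right, ih]
    split_ifs
    · rw [show 3 * (a + 1) + 3 = 3 * a + 3 + 1 + 1 + 1 by ring,
        Nat.factorial_succ (3 * a + 3 + 1 + 1), Nat.factorial_succ (3 * a + 3 + 1),
        Nat.factorial_succ (3 * a + 3), pow_succ]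
      generalize (3 * a + 3)! = p
      push_cast
      field_simp
      ring
    · ring

theorem fockInner_harmonic (hT : IsSU3Generators T) (a b : ℕ) :
    fockInner (harmonic T a) (harmonic T b) =
      if a = b then (1 / 6 : ℂ) * (1 / 24 ^ a) * ((3 * a + 3)! : ℂ) else 0 := by
  rcases le_total b a with h | h
  · obtain ⟨c, rfl⟩ := Nat.exists_eq_add_of_le h
    rw [fockInner_harmonic_add hT]
    rcases c with _ | c <;> simp
  · obtain ⟨c, rfl⟩ := Nat.exists_eq_add_of_le h
    rw [← conj_fockInner, fockInner_harmonic_add hT]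
    rcases c with _ | c
    · simp only [if_pos, map_mul, map_div₀, map_pow, map_one, map_ofNat, map_natCast, add_zero]
    · simp

/-- Factors `q` are cancelled pairwise as half Laplacians; a surplus on either side meets a harmonic
polynomial and gives zero. -/
theorem fockInner_quad_pow_harmonic (hT : IsSU3Generators T) (a b n m : ℕ) :
    fockInner (quad T ^ n * harmonic T a) (quad T ^ m * harmonic T b) =
      if a = b ∧ n = m then
        (1 / 6 : ℂ) * (1 / 24 ^ a) * (n ! : ℂ) * ((n + 3 * a + 3)! : ℂ) else 0 := by
  induction n generalizing m with
  | zero =>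
    rcases m with _ | m
    · simp [fockInner_harmonic hT]
    · rw [← conj_fockInner, pow_succ', pow_zero, one_mul, mul_assoc,
        fockInner_quad_mul_harmonic hT]
      simp
  | succ n ih =>
    rw [pow_succ', mul_assoc]
    rcases m with _ | m
    · rw [pow_zero, one_mul, fockInner_quad_mul_harmonic hT]
      simp
    · rw [fockInner_quad_mul hT, halfLaplacian_quad_pow_mul_harmonic hT, fockInner_smul_right, ih]
      by_cases h : a = b ∧ n = m
      · obtain ⟨rfl, rfl⟩ := h
        rw [if_pos ⟨rfl, rfl⟩, if_pos ⟨rfl, rfl⟩,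
          show n + 1 + 3 * a + 3 = n + 3 * a + 3 + 1 by ring, Nat.factorial_succ n,
          Nat.factorial_succ (n + 3 * a + 3)]
        generalize (n + 3 * a + 3)! = p
        generalize n ! = q
        push_cast
        ring
      · rw [if_neg h, if_neg (by simpa using h), mul_zero]

/-! ### The orthogonalized Fock states -/

theorem harmonic_eq_sum (k : ℕ) : harmonic T k =
    ∑ s ∈ Finset.range (k + 1), ((-1 / 24 : ℂ) ^ s * ((k - s).choose s : ℂ)) •
      (quad T ^ (3 * s) * cub T ^ (k - 2 * s)) := by
  induction k using Nat.twoStepInduction with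
  | zero => simp [harmonic]
  | one => simp [harmonic, Finset.sum_range_succ]
  | more k h0 h1 =>
    have hc : MvPolynomial.C (1 / 24) * quad T ^ 3 * harmonic T k =
        (1 / 24 : ℂ) • (quad T ^ 3 * harmonic T k) := by
      rw [MvPolynomial.smul_eq_C_mul, mul_assoc]
    rw [harmonic, hc, h1, h0, Finset.sum_range_succ', Finset.sum_range_succ' _ (k + 2),
      Finset.sum_range_succ _ (k + 1), mul_add, Finset.mul_sum, Finset.mul_sum, Finset.smul_sum,
      add_sub_right_comm, ← Finset.sum_sub_distrib]
    congr 1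
    · rw [Nat.choose_eq_zero_of_lt (show k + 2 - (k + 1 + 1) < k + 1 + 1 by omega)]
      simp only [Nat.cast_zero, mul_zero, zero_smul, add_zero]
      refine Finset.sum_congr rfl fun s hs => ?_
      have hs' : s ≤ k := Nat.lt_succ_iff.1 (Finset.mem_range.1 hs)
      rw [show k + 1 - (s + 1) = k - s by omega, show k + 2 - (s + 1) = (k - s) + 1 by omega,
        Nat.choose_succ_succ, show k + 2 - 2 * (s + 1) = k - 2 * s by omega]
      -- Pascal's rule matches the recursion. If `2 * s + 1 > k`, the truncated exponent of `c` is
      -- meaningless, but its binomial is zero.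
      by_cases h : 2 * s + 1 ≤ k
      · rw [show k - 2 * s = k + 1 - 2 * (s + 1) + 1 by omega]
        simp only [MvPolynomial.smul_eq_C_mul]
        push_cast
        simp only [map_mul, map_add, map_pow, neg_div, map_neg]
        ring
      · rw [Nat.choose_eq_zero_of_lt (show k - s < s + 1 by omega)]
        simp only [MvPolynomial.smul_eq_C_mul]
        push_cast
        simp only [map_mul, map_add, map_pow, neg_div, map_neg, map_zero]
        ring
    · simp
      ring

/-- In this form the coefficients of the barred state are visibly those of `harmonic T (2 * κ)`. -/
theorem gammaEven_sub {κ s : ℕ} (hs : s ≤ κ) :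
    gammaEven κ (κ - s) = (-1 / 24 : ℝ) ^ s * ((2 * κ - s).choose s : ℝ) := by
  have h1 : (((κ - s : ℕ) : ℤ) - (κ : ℤ)) = -(s : ℤ) := by omega
  rw [gammaEven, h1, zpow_neg, zpow_natCast, show κ + (κ - s) = 2 * κ - s by omega,
    show κ - (κ - s) = s by omega, Nat.cast_choose ℝ (show s ≤ 2 * κ - s by omega),
    show 2 * (κ - s) = 2 * κ - s - s by omega, ← inv_pow, mul_div_assoc]
  norm_num

theorem gammaEven_self (κ : ℕ) : gammaEven κ κ = 1 := by
  simpa using gammaEven_sub (Nat.zero_le κ)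

theorem barState_eq_sum (n κ : ℕ) : barState T n κ = ∑ t ∈ Finset.range (κ + 1),
    ((gammaEven κ (κ - t) : ℝ) : ℂ) • fockState T (n + 3 * t) (2 * (κ - t)) := by
  have hI : Finset.Icc 1 κ = Finset.Ico (0 + 1) (κ + 1) := by
    ext t
    simp only [Finset.mem_Icc, Finset.mem_Ico]
    omega
  rw [Finset.sum_range_succ', barState, add_comm, hI, ← Finset.sum_Ico_add', Finset.range_eq_Ico]
  simp only [Nat.mul_sub, gammaEven_self, Nat.sub_zero, mul_zero, add_zero, Complex.ofReal_one,
    one_smul]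

theorem barState_eq (n κ : ℕ) : barState T n κ = quad T ^ n * harmonic T (2 * κ) := by
  rw [barState_eq_sum, harmonic_eq_sum, Finset.mul_sum]
  rw [← Finset.sum_subset (Finset.range_subset_range.2 (show κ + 1 ≤ 2 * κ + 1 by omega))]
  · refine Finset.sum_congr rfl fun s hs => ?_
    rw [gammaEven_sub (Nat.lt_succ_iff.1 (Finset.mem_range.1 hs)), fockState_eq, mul_smul_comm,
      ← mul_assoc, ← pow_add, Nat.mul_sub]
    push_cast
    rfl
  · intro s _ hs
    rw [Finset.mem_range] at hs
    rw [Nat.choose_eq_zero_of_lt (by omega)]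
    simp

theorem fockInner_barState (hT : IsSU3Generators T) (α β n m : ℕ) :
    fockInner (barState T n α) (barState T m β) =
      if α = β ∧ n = m then
        (1 / 6 : ℂ) * (1 / 24 ^ (2 * α)) * (n ! : ℂ) * ((n + 6 * α + 3)! : ℂ)
      else 0 := by
  rw [barState_eq, barState_eq, fockInner_quad_pow_harmonic hT]
  simp only [← mul_assoc, Nat.mul_left_cancel_iff (show 0 < 2 by norm_num)]
  rfl

/-! ### Action of the Hamiltonian -/

theorem hamiltonian_barState_zero (hT : IsSU3Generators T) (κ : ℕ) :
    hamiltonian T (barState T 0 κ) =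
      (3 * κ + 2 : ℂ) • barState T 0 κ - (1 / 2 : ℂ) • barState T 1 κ := by
  rw [barState_eq, barState_eq, hamiltonian_apply hT,
    gradInner_quad_of_isHomogeneous hT (isHomogeneous_quad_pow_mul_harmonic 0 (2 * κ)),
    pow_zero, one_mul, pow_one, halfLaplacian_harmonic hT, ← nsmul_eq_mul,
    ← Nat.cast_smul_eq_nsmul ℂ]
  push_cast
  module

theorem hamiltonian_barState_succ (hT : IsSU3Generators T) (n κ : ℕ) :
    hamiltonian T (barState T (n + 1) κ) =
      (n + 3 * κ + 3 : ℂ) • barState T (n + 1) κ - (1 / 2 : ℂ) • barState T (n + 2) κ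
        - ((n + 1) * (n + 6 * κ + 4) / 2 : ℂ) • barState T n κ := by
  rw [barState_eq, barState_eq, barState_eq, hamiltonian_apply hT,
    gradInner_quad_of_isHomogeneous hT (isHomogeneous_quad_pow_mul_harmonic (n + 1) (2 * κ)),
    halfLaplacian_quad_pow_mul_harmonic hT, ← mul_assoc (quad T), ← pow_succ', ← nsmul_eq_mul,
    ← Nat.cast_smul_eq_nsmul ℂ]
  push_cast
  module

/-- The recurrence at `x = 2e` is the eigenvalue equation read at each inner barred state, so only
terms at the upper end survive. -/
theorem hamiltonian_sum_barState (hT : IsSU3Generators T) (κ : ℕ) (e : ℂ) {s : ℕ → ℂ}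
    (hs : IsSonineSeq (6 * κ + 3) (2 * e) s) (d : ℕ) :
    hamiltonian T (∑ n ∈ Finset.range (d + 1), s n • barState T n κ) =
      e • ∑ n ∈ Finset.range (d + 1), s n • barState T n κ
        - (s d / 2) • barState T (d + 1) κ
        + ((d + 1) * (d + 6 * κ + 4) / 2 * s (d + 1)) • barState T d κ := by
  induction d with
  | zero =>
    have h := hs.one
    push_cast at h
    rw [zero_add, Finset.sum_range_one, map_smul, hamiltonian_barState_zero hT]
    push_cast
    linear_combination (norm := module) (-1 / 2 : ℂ) • h • barState T 0 κ
  | succ d ih =>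
    have h := hs.add_two d
    push_cast at h
    rw [Finset.sum_range_succ, map_add, ih, map_smul, hamiltonian_barState_succ hT]
    push_cast
    linear_combination (norm := module) (-1 / 2 : ℂ) • h • barState T (d + 1) κ

theorem cutProjection_of_isHomogeneous {f : Fock} {n : ℕ} (hf : f.IsHomogeneous n) (N : ℕ) :
    cutProjection N f = if n ≤ N then f else 0 := by
  have h : ∀ i, MvPolynomial.homogeneousComponent i f = if i = n then f else 0 := fun i =>
    MvPolynomial.homogeneousComponent_of_mem hf
  simp [cutProjection, LinearMap.sum_apply, h]

theorem cutProjection_barState (N n κ : ℕ) :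
    cutProjection N (barState T n κ) = if 2 * n + 6 * κ ≤ N then barState T n κ else 0 := by
  rw [barState_eq, cutProjection_of_isHomogeneous (isHomogeneous_quad_pow_mul_harmonic n (2 * κ))]
  simp only [← mul_assoc]
  rfl

theorem isSonineSeq_ofReal {a : ℕ} {x : ℝ} {s : ℕ → ℝ} (hs : IsSonineSeq a x s) :
    IsSonineSeq a (x : ℂ) fun n => (s n : ℂ) where
  one := by exact_mod_cast congrArg (Complex.ofReal) hs.one
  add_two n := by exact_mod_cast congrArg (Complex.ofReal) (hs.add_two n)

theorem cutHamiltonian_energyState (hT : IsSU3Generators T) {N κ : ℕ} (hκ : κ ≤ N / 6) {e : ℝ}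
    (he : sonine (dim N κ) (6 * κ + 3) (2 * e) = 0) :
    cutHamiltonian T N (energyState T N κ e) = (e : ℂ) • energyState T N κ e := by
  have hs := isSonineSeq_ofReal (isSonineSeq_sonine (6 * κ + 3) (2 * e))
  rw [Complex.ofReal_mul, Complex.ofReal_ofNat] at hs
  obtain ⟨d, hd⟩ : ∃ d, d = (N - 6 * κ) / 2 := ⟨_, rfl⟩
  have hdim : dim N κ = d + 1 := by rw [dim, hd]
  have h := hamiltonian_sum_barState hT κ e hs d
  rw [hdim] at he
  rw [he, Complex.ofReal_zero, mul_zero, zero_smul, add_zero] at h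
  rw [energyState, map_smul, cutHamiltonian, Module.End.mul_apply, hdim, h, smul_comm (e : ℂ)]
  congr 1
  -- The barred state with index `d + 1` has `2 (d + 1) + 6 κ > N` quanta, since `d` is the floor of
  -- `(N - 6 κ) / 2`.
  rw [map_sub, map_smul, map_smul, map_sum, cutProjection_barState, if_neg (by omega), smul_zero,
    sub_zero]
  congr 1
  refine Finset.sum_congr rfl fun n hn => ?_
  rw [Finset.mem_range] at hn
  rw [map_smul, cutProjection_barState, if_pos (by omega)]

/-! ### Scalar products of the energy eigenstates -/

theorem fockInner_energyState_of_ne (hT : IsSU3Generators T) (N : ℕ) {κ κ' : ℕ} (h : κ ≠ κ')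
    (e e' : ℝ) : fockInner (energyState T N κ e) (energyState T N κ' e') = 0 := by
  simp only [energyState, fockInner_smul_left, fockInner_smul_right, fockInner_sum_left,
    fockInner_sum_right, fockInner_barState hT, h, false_and, if_false, mul_zero,
    Finset.sum_const_zero]

theorem fockInner_energyState (hT : IsSU3Generators T) (N κ : ℕ) (e e' : ℝ) :
    fockInner (energyState T N κ e) (energyState T N κ e') =
      (((2 * e) ^ (3 * κ) * Real.exp (-e) * ((2 * e') ^ (3 * κ) * Real.exp (-e')) *
        (1 / 6 * (1 / 24 ^ (2 * κ))) *
        ∑ n ∈ Finset.range (dim N κ), (n ! : ℝ) * (n + (6 * κ + 3))! *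
          (sonine n (6 * κ + 3) (2 * e) * sonine n (6 * κ + 3) (2 * e')) : ℝ) : ℂ) := by
  have key : fockInner
      (∑ n ∈ Finset.range (dim N κ), ((sonine n (6 * κ + 3) (2 * e) : ℝ) : ℂ) • barState T n κ)
      (∑ n ∈ Finset.range (dim N κ), ((sonine n (6 * κ + 3) (2 * e') : ℝ) : ℂ) • barState T n κ) =
      ((1 / 6 * (1 / 24 ^ (2 * κ)) * ∑ n ∈ Finset.range (dim N κ), (n ! : ℝ) * (n + (6 * κ + 3))! *
          (sonine n (6 * κ + 3) (2 * e) * sonine n (6 * κ + 3) (2 * e')) : ℝ) : ℂ) := by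
    rw [fockInner_sum_left, Finset.mul_sum, Complex.ofReal_sum]
    refine Finset.sum_congr rfl fun n hn => ?_
    rw [fockInner_sum_right, Finset.sum_eq_single n]
    · rw [fockInner_smul_left, fockInner_smul_right, fockInner_barState hT, if_pos ⟨rfl, rfl⟩,
        Complex.conj_ofReal, add_assoc n]
      push_cast
      ring
    · intro m _ hm
      rw [fockInner_smul_left, fockInner_smul_right, fockInner_barState hT,
        if_neg fun h => hm h.2.symm, mul_zero, mul_zero]
    · exact fun h => absurd hn h
  rw [energyState, energyState, fockInner_smul_left, fockInner_smul_right, key,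
    Complex.conj_ofReal, ← Complex.ofReal_mul, ← Complex.ofReal_mul]
  congr 1
  ring

theorem fockInner_energyState_of_root_ne (hT : IsSU3Generators T) {N κ : ℕ} {e e' : ℝ}
    (he : sonine (dim N κ) (6 * κ + 3) (2 * e) = 0)
    (he' : sonine (dim N κ) (6 * κ + 3) (2 * e') = 0) (hne : e ≠ e') :
    fockInner (energyState T N κ e) (energyState T N κ e') = 0 := by
  have h := (isSonineSeq_sonine (6 * κ + 3) (2 * e)).christoffel_darboux
    (isSonineSeq_sonine (6 * κ + 3) (2 * e')) ((N - 6 * κ) / 2)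
  rw [dim] at he he'
  simp only [he, he', mul_zero, zero_mul, sub_zero] at h
  have h2 : 2 * e - 2 * e' ≠ 0 := fun h => hne (by linarith)
  rw [fockInner_energyState hT, dim, (mul_eq_zero.1 h).resolve_left h2, mul_zero,
    Complex.ofReal_zero]

theorem fockInner_energyState_self (hT : IsSU3Generators T) {N κ : ℕ} {e : ℝ}
    (he : sonine (dim N κ) (6 * κ + 3) (2 * e) = 0) :
    fockInner (energyState T N κ e) (energyState T N κ e) =
      ((Real.exp (-(2 * e)) * (2 * e) ^ (6 * κ) * (1 / 6) * (1 / 24 ^ (2 * κ)) *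
        (((dim N κ)! : ℝ) / ((dim N κ + 6 * κ + 2)! : ℝ)) *
        (laguerre (dim N κ - 1) (6 * κ + 3)).eval (2 * e) *
        (laguerre (dim N κ - 1) (6 * κ + 4)).eval (2 * e) : ℝ) : ℂ) := by
  obtain ⟨d, hd⟩ : ∃ d, dim N κ = d + 1 := ⟨_, rfl⟩
  rw [hd, sonine_eq_zero_iff] at he
  have h := sum_sonine_sq_of_root _ _ _ he
  simp only [pow_two] at h
  rw [fockInner_energyState hT, hd, h, Nat.add_sub_cancel,
    show d + 1 + 6 * κ + 2 = d + (6 * κ + 3) by ring]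
  congr 1
  rw [show -(2 * e) = -e + -e by ring, Real.exp_add, show 6 * κ = 3 * κ + 3 * κ by ring, pow_add]
  ring

theorem fockInner_energyState_self_ne_zero (hT : IsSU3Generators T) {N κ : ℕ} {e : ℝ}
    (he : 0 < e) : fockInner (energyState T N κ e) (energyState T N κ e) ≠ 0 := by
  rw [fockInner_energyState hT, Complex.ofReal_ne_zero]
  have hpos := sum_sonine_sq_pos (6 * κ + 3) (2 * e) ((N - 6 * κ) / 2)
  simp only [pow_two] at hpos
  refine (mul_pos ?_ hpos).ne'
  positivity

theorem energyState_ne_zero (hT : IsSU3Generators T) {N κ : ℕ} {e : ℝ} (he : 0 < e) :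
    energyState T N κ e ≠ 0 := fun h =>
  fockInner_energyState_self_ne_zero hT (N := N) (κ := κ) he (by rw [h, fockInner_zero_left])

/-! ### Energy levels -/

theorem IsEnergyLevels.sonine_eq_zero {N : ℕ} {E : (κ : Fin (N / 6 + 1)) → Fin (dim N κ) → ℝ}
    (hE : IsEnergyLevels N E) (κ : Fin (N / 6 + 1)) (m : Fin (dim N κ)) :
    sonine (dim N κ) (6 * (κ : ℕ) + 3) (2 * E κ m) = 0 := by
  have h : E κ m ∈ Set.range (E κ) := ⟨m, rfl⟩
  rwa [(hE κ).2] at h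

theorem IsEnergyLevels.pos {N : ℕ} {E : (κ : Fin (N / 6 + 1)) → Fin (dim N κ) → ℝ}
    (hE : IsEnergyLevels N E) (κ : Fin (N / 6 + 1)) (m : Fin (dim N κ)) : 0 < E κ m := by
  have h := (sonine_eq_zero_iff _ _ _).1 (hE.sonine_eq_zero κ m)
  have h2 := pos_of_mem_roots_laguerre ((Polynomial.mem_roots (laguerre_ne_zero _ _)).2 h)
  linarith

theorem existsUnique_isEnergyLevels (N : ℕ) :
    ∃! E : (κ : Fin (N / 6 + 1)) → Fin (dim N κ) → ℝ, IsEnergyLevels N E := by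
  classical
  have hcard : ∀ κ : ℕ, (laguerre (dim N κ) (6 * κ + 3)).roots.toFinset.card = dim N κ :=
    fun κ => by
      rw [Multiset.toFinset_card_of_nodup (nodup_roots_laguerre _ _), card_roots_laguerre]
  obtain ⟨E, hE⟩ : ∃ E, IsEnergyLevels N E := by
    refine ⟨fun κ m => ((laguerre (dim N κ) (6 * κ + 3)).roots.toFinset.orderEmbOfFin
      (hcard κ) m) / 2, fun κ => ⟨?_, ?_⟩⟩
    · intro m m' h
      have := ((laguerre (dim N κ) (6 * κ + 3)).roots.toFinset.orderEmbOfFin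
        (hcard κ)).strictMono h
      simp only
      linarith
    · ext e
      have hr : 2 * e ∈ Set.range ((laguerre (dim N κ) (6 * κ + 3)).roots.toFinset.orderEmbOfFin
          (hcard κ)) ↔ sonine (dim N κ) (6 * κ + 3) (2 * e) = 0 := by
        rw [Finset.range_orderEmbOfFin, Finset.mem_coe, Multiset.mem_toFinset,
          Polynomial.mem_roots (laguerre_ne_zero _ _), sonine_eq_zero_iff]
      rw [Set.mem_ofPred_eq, ← hr]
      constructor
      · rintro ⟨m, rfl⟩
        exact ⟨m, by ring⟩
      · rintro ⟨m, hm⟩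
        exact ⟨m, by simp only [hm]; ring⟩
  exact ⟨E, hE, fun E' hE' => funext fun κ =>
    ((hE' κ).1.range_inj (hE κ).1).1 ((hE' κ).2.trans (hE κ).2.symm)⟩

/-! ### Transformation matrices -/

theorem barState_eq_sum_matrixT₁ {N : ℕ} (i : Label N) : barState T i.2 i.1 =
    ∑ j : Label N, ((matrixT₁ N i j : ℝ) : ℂ) • fockState T j.2 (2 * (j.1 : ℕ)) := by
  classical
  obtain ⟨⟨κ, hκ⟩, ⟨n, hn⟩⟩ := i
  simp only [matrixT₁, Matrix.of_apply, apply_ite Complex.ofReal, Complex.ofReal_zero, ite_smul,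
    zero_smul]
  rw [← Finset.sum_filter, barState_eq_sum]
  symm
  refine Finset.sum_bij (fun j _ => κ - (j.1 : ℕ)) ?_ ?_ ?_ ?_
  · intro j _
    exact Finset.mem_range.2 (by omega)
  · rintro ⟨⟨k, hk⟩, ⟨m, hm⟩⟩ hj ⟨⟨k', hk'⟩, ⟨m', hm'⟩⟩ hj' h
    simp only [Finset.mem_filter, Finset.mem_univ, true_and] at hj hj' h
    obtain rfl : k = k' := by omega
    obtain rfl : m = m' := by omega
    rfl
  · intro t ht
    rw [Finset.mem_range] at ht
    refine ⟨⟨⟨κ - t, by omega⟩, ⟨n + 3 * t, ?_⟩⟩, ?_, ?_⟩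
    -- Trading `2t` cubic bricks for `3t` quadratic ones keeps the number of quanta, and the family
    -- `κ - t` has exactly `3t` more states.
    · simp only [dim] at hn ⊢
      omega
    · simp only [Finset.mem_filter, Finset.mem_univ, true_and]
      omega
    · simp only
      omega
  · rintro ⟨⟨k, hk⟩, ⟨m, hm⟩⟩ hj
    simp only [Finset.mem_filter, Finset.mem_univ, true_and] at hj ⊢
    rw [hj.2, Nat.sub_sub_self hj.1]

theorem matrixT₁_self {N : ℕ} (i : Label N) : matrixT₁ N i i = 1 := by
  simp [matrixT₁, gammaEven_self]

theorem matrixT₁_eq_zero_of_lex {N : ℕ} {i j : Label N}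
    (h : Sigma.Lex (· < ·) (fun _ => (· < ·)) i j) : matrixT₁ N i j = 0 := by
  rw [matrixT₁, Matrix.of_apply, if_neg]
  rintro ⟨h1, h2⟩
  rcases h with ⟨a, b, h⟩ | ⟨a, b, h⟩
  · have := Fin.lt_def.1 h
    simp only at h1
    omega
  · have := Fin.lt_def.1 h
    simp only at h2
    omega

theorem det_matrixT₁ (N : ℕ) : (matrixT₁ N).det = 1 := by
  -- Triangularity refers to the lexicographic order, so the labels are transported to the type that
  -- carries it.
  have h : ((matrixT₁ N).submatrix (fun i : Σₗ κ : Fin (N / 6 + 1), Fin (dim N κ) => ofLex i)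
      (fun i => ofLex i)).det = 1 := by
    rw [Matrix.det_of_isLowerTriangular]
    · exact Finset.prod_eq_one fun i _ => matrixT₁_self _
    · intro i j hij
      exact matrixT₁_eq_zero_of_lex hij
  rw [← h]
  exact (Matrix.det_submatrix_equiv_self ofLex (matrixT₁ N)).symm

theorem energyState_eq_sum_matrixT₂ {N : ℕ}
    (E : (κ : Fin (N / 6 + 1)) → Fin (dim N κ) → ℝ) (i : Label N) :
    energyState T N i.1 (E i.1 i.2) =
      ∑ j : Label N, ((matrixT₂ N E i j : ℝ) : ℂ) • barState T j.2 j.1 := by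
  obtain ⟨κ, m⟩ := i
  rw [Fintype.sum_sigma, Finset.sum_eq_single κ]
  · simp only [matrixT₂, Matrix.blockDiagonal'_apply_eq, Matrix.diagonal_mul, laguerreMatrix,
      Matrix.of_apply]
    rw [energyState, Finset.smul_sum, Finset.sum_range]
    refine Finset.sum_congr rfl fun n _ => ?_
    rw [smul_smul, ← Complex.ofReal_mul]
  · intro κ' _ hne
    refine Finset.sum_eq_zero fun n _ => ?_
    rw [matrixT₂, Matrix.blockDiagonal'_apply_ne _ _ _ hne.symm, Complex.ofReal_zero, zero_smul]
  · simp

theorem energyState_eq_sum_mul {N : ℕ}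
    (E : (κ : Fin (N / 6 + 1)) → Fin (dim N κ) → ℝ) (i : Label N) :
    energyState T N i.1 (E i.1 i.2) =
      ∑ j : Label N, (((matrixT₂ N E * matrixT₁ N) i j : ℝ) : ℂ) •
        fockState T j.2 (2 * (j.1 : ℕ)) := by
  rw [energyState_eq_sum_matrixT₂]
  simp only [barState_eq_sum_matrixT₁, Finset.smul_sum, smul_smul]
  rw [Finset.sum_comm]
  refine Finset.sum_congr rfl fun j _ => ?_
  rw [← Finset.sum_smul, Matrix.mul_apply, Complex.ofReal_sum]
  simp only [Complex.ofReal_mul]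

theorem det_matrixT₂_ne_zero {N : ℕ} {E : (κ : Fin (N / 6 + 1)) → Fin (dim N κ) → ℝ}
    (hE : IsEnergyLevels N E) : (matrixT₂ N E).det ≠ 0 := by
  have hu : ∀ κ, IsUnit (Matrix.diagonal (fun m => (2 * E κ m) ^ (3 * (κ : ℕ)) *
      Real.exp (-(E κ m))) * laguerreMatrix κ (E κ)).det := by
    intro κ
    rw [isUnit_iff_ne_zero, Matrix.det_mul, Matrix.det_diagonal]
    refine mul_ne_zero (Finset.prod_ne_zero_iff.2 fun m _ => ?_)
      (det_laguerreMatrix_ne_zero _ (hE κ).1)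
    have := hE.pos κ m
    positivity
  refine Matrix.det_ne_zero_of_right_inverse (B := Matrix.blockDiagonal' fun κ =>
    (Matrix.diagonal (fun m => (2 * E κ m) ^ (3 * (κ : ℕ)) * Real.exp (-(E κ m))) *
      laguerreMatrix κ (E κ))⁻¹) ?_
  rw [matrixT₂, ← Matrix.blockDiagonal'_mul]
  simp only [Matrix.mul_nonsing_inv _ (hu _)]
  exact Matrix.blockDiagonal'_one

/-! ### Bases of the even sector -/

theorem linearIndependent_of_fockInner {ι : Type*} {v : ι → Fock}
    (h0 : ∀ i, fockInner (v i) (v i) ≠ 0)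
    (h : ∀ i j, i ≠ j → fockInner (v i) (v j) = 0) : LinearIndependent ℂ v := by
  classical
  rw [linearIndependent_iff']
  intro s g hg i hi
  have h1 := congrArg (fockInner (v i)) hg
  rw [fockInner_sum_right, fockInner_zero_right, Finset.sum_eq_single i] at h1
  · rw [fockInner_smul_right] at h1
    exact (mul_eq_zero.1 h1).resolve_right (h0 i)
  · intro j _ hj
    rw [fockInner_smul_right, h i j hj.symm, mul_zero]
  · exact fun h => absurd hi h

theorem evenSector_eq (N : ℕ) : evenSector T N =
    Submodule.span ℂ (Set.range fun i : Label N => fockState T i.2 (2 * (i.1 : ℕ))) := by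
  rw [evenSector]
  congr 1
  ext v
  constructor
  · rintro ⟨j, k, hjk, rfl⟩
    exact ⟨⟨⟨k, by omega⟩, ⟨j, by simp only [dim]; omega⟩⟩, rfl⟩
  · rintro ⟨⟨⟨k, hk⟩, ⟨j, hj⟩⟩, rfl⟩
    simp only [dim] at hj
    exact ⟨j, k, by omega, rfl⟩

/-- A family in the span of another family with the same finite index type, if linearly
independent, forces the other family to be linearly independent with the same span. -/
theorem linearIndependent_and_span_eq {K V ι : Type*} [Field K] [AddCommGroup V] [Module K V]
    [Fintype ι] {v w : ι → V} (hv : LinearIndependent K v)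
    (h : ∀ i, v i ∈ Submodule.span K (Set.range w)) :
    LinearIndependent K w ∧ Submodule.span K (Set.range v) = Submodule.span K (Set.range w) := by
  have hle : Submodule.span K (Set.range v) ≤ Submodule.span K (Set.range w) := by
    rw [Submodule.span_le]
    rintro _ ⟨i, rfl⟩
    exact h i
  have hfin : FiniteDimensional K (Submodule.span K (Set.range w)) :=
    FiniteDimensional.span_of_finite K (Set.finite_range w)
  have hcard : Module.finrank K (Submodule.span K (Set.range v)) = Fintype.card ι :=
    finrank_span_eq_card hv
  have hw : LinearIndependent K w := by
    rw [linearIndependent_iff_card_le_finrank_span, Set.finrank, ← hcard]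
    exact Submodule.finrank_mono hle
  exact ⟨hw, Submodule.eq_of_le_of_finrank_eq hle (hcard.trans (finrank_span_eq_card hw).symm)⟩

end SYMQM

end

open SYMQM in
theorem mainTheorem8 (T : Fin 8 → Matrix (Fin 3) (Fin 3) ℂ) (hT : IsSU3Generators T) (N : ℕ) :
    -- scalar products of the orthogonalized Fock states
    (∀ α β n m : ℕ, fockInner (barState T n α) (barState T m β) =
      if α = β ∧ n = m then
        (1 / 6 : ℂ) * (1 / 24 ^ (2 * α)) * (n ! : ℂ) * ((n + 6 * α + 3)! : ℂ)
      else 0) ∧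
    -- simplicity and positivity of the roots in the quantization conditions
    (∀ κ : ℕ, κ ≤ N / 6 →
      (laguerre (dim N κ) (6 * κ + 3)).natDegree = dim N κ ∧
      (laguerre (dim N κ) (6 * κ + 3)).roots.card = dim N κ ∧
      (laguerre (dim N κ) (6 * κ + 3)).roots.Nodup ∧
      ∀ x ∈ (laguerre (dim N κ) (6 * κ + 3)).roots, 0 < x) ∧
    (∃! E : (κ : Fin (N / 6 + 1)) → Fin (dim N κ) → ℝ, IsEnergyLevels N E) ∧
    ∀ E : (κ : Fin (N / 6 + 1)) → Fin (dim N κ) → ℝ, IsEnergyLevels N E →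
      -- the states are eigenstates of the cut Hamiltonian
      (∀ i : Label N, energyState T N i.1 (E i.1 i.2) ≠ 0 ∧
        cutHamiltonian T N (energyState T N i.1 (E i.1 i.2)) =
          ((E i.1 i.2 : ℝ) : ℂ) • energyState T N i.1 (E i.1 i.2)) ∧
      -- orthogonality, across families and within each family
      (∀ i j : Label N, i ≠ j →
        fockInner (energyState T N i.1 (E i.1 i.2)) (energyState T N j.1 (E j.1 j.2)) = 0) ∧
      -- norms
      (∀ i : Label N,
        fockInner (energyState T N i.1 (E i.1 i.2)) (energyState T N i.1 (E i.1 i.2)) =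
          ((Real.exp (-(2 * E i.1 i.2)) * (2 * E i.1 i.2) ^ (6 * (i.1 : ℕ)) *
            (1 / 6) * (1 / 24 ^ (2 * (i.1 : ℕ))) *
            (((dim N i.1)! : ℝ) / ((dim N i.1 + 6 * (i.1 : ℕ) + 2)! : ℝ)) *
            (laguerre (dim N i.1 - 1) (6 * (i.1 : ℕ) + 3)).eval (2 * E i.1 i.2) *
            (laguerre (dim N i.1 - 1) (6 * (i.1 : ℕ) + 4)).eval (2 * E i.1 i.2) : ℝ) : ℂ)) ∧
      -- the transformation from the Fock states is `T₂ * T₁`, with `T₁` unitriangular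
      (∀ i : Label N, barState T i.2 i.1 =
        ∑ j : Label N, ((matrixT₁ N i j : ℝ) : ℂ) • fockState T j.2 (2 * (j.1 : ℕ))) ∧
      (∀ i : Label N, matrixT₁ N i i = 1) ∧
      (∀ i j : Label N, Sigma.Lex (· < ·) (fun _ => (· < ·)) i j → matrixT₁ N i j = 0) ∧
      (∀ i : Label N, energyState T N i.1 (E i.1 i.2) =
        ∑ j : Label N, ((matrixT₂ N E i j : ℝ) : ℂ) • barState T j.2 j.1) ∧
      (∀ i : Label N, energyState T N i.1 (E i.1 i.2) =
        ∑ j : Label N, (((matrixT₂ N E * matrixT₁ N) i j : ℝ) : ℂ) •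
          fockState T j.2 (2 * (j.1 : ℕ))) ∧
      -- the blocks of `T₂` have Vandermonde determinants, and the transformation is nonsingular
      (∀ κ : Fin (N / 6 + 1),
        (laguerreMatrix κ (E κ)).det =
          (∏ k : Fin (dim N κ), (-1 : ℝ) ^ (k : ℕ) /
            (((k : ℕ)! : ℝ) * ((6 * (κ : ℕ) + 3 + (k : ℕ))! : ℝ))) *
            ∏ i : Fin (dim N κ), ∏ j ∈ Finset.Ioi i, (2 * E κ j - 2 * E κ i) ∧
        (laguerreMatrix κ (E κ)).det ≠ 0) ∧
      (matrixT₁ N).det = 1 ∧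
      (matrixT₂ N E * matrixT₁ N).det ≠ 0 ∧
      -- both the Fock states and the energy eigenstates are bases of the even sector
      LinearIndependent ℂ (fun i : Label N => fockState T i.2 (2 * (i.1 : ℕ))) ∧
      LinearIndependent ℂ (fun i : Label N => energyState T N i.1 (E i.1 i.2)) ∧
      Submodule.span ℂ (Set.range fun i : Label N => energyState T N i.1 (E i.1 i.2)) =
        evenSector T N := by
  refine ⟨fockInner_barState hT, fun κ _ => ⟨natDegree_laguerre _ _, card_roots_laguerre _ _,
    nodup_roots_laguerre _ _, fun x hx => pos_of_mem_roots_laguerre hx⟩,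
    existsUnique_isEnergyLevels N, fun E hE => ?_⟩
  have hne : ∀ i : Label N, energyState T N i.1 (E i.1 i.2) ≠ 0 := fun i =>
    energyState_ne_zero hT (hE.pos i.1 i.2)
  have horth : ∀ i j : Label N, i ≠ j →
      fockInner (energyState T N i.1 (E i.1 i.2)) (energyState T N j.1 (E j.1 j.2)) = 0 := by
    rintro ⟨κ, m⟩ ⟨κ', m'⟩ hij
    by_cases h : κ = κ'
    · subst h
      exact fockInner_energyState_of_root_ne hT (hE.sonine_eq_zero κ m) (hE.sonine_eq_zero κ m')
        fun h => hij (congrArg (Sigma.mk κ) ((hE κ).1.injective h))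
    · exact fockInner_energyState_of_ne hT N (fun h' => h (Fin.ext h')) _ _
  have hind : LinearIndependent ℂ fun i : Label N => energyState T N i.1 (E i.1 i.2) :=
    linearIndependent_of_fockInner
      (fun i => fockInner_energyState_self_ne_zero hT (hE.pos i.1 i.2)) horth
  -- Independence of the Fock states comes from a dimension count with the orthogonal energy states.
  obtain ⟨hfock, hspan⟩ := linearIndependent_and_span_eq
    (w := fun i : Label N => fockState T i.2 (2 * (i.1 : ℕ))) hind fun i => by
      rw [energyState_eq_sum_mul]
      exact Submodule.sum_mem _ fun j _ =>
        Submodule.smul_mem _ _ (Submodule.subset_span ⟨j, rfl⟩)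
  refine ⟨fun i => ⟨hne i, cutHamiltonian_energyState hT (Nat.lt_succ_iff.1 i.1.2)
    (hE.sonine_eq_zero i.1 i.2)⟩, horth,
    fun i => fockInner_energyState_self hT (hE.sonine_eq_zero i.1 i.2),
    barState_eq_sum_matrixT₁, matrixT₁_self, fun i j => matrixT₁_eq_zero_of_lex,
    energyState_eq_sum_matrixT₂ E, energyState_eq_sum_mul E,
    fun κ => ⟨det_laguerreMatrix _ _, det_laguerreMatrix_ne_zero _ (hE κ).1⟩,
    det_matrixT₁ N, ?_, hfock, hind, hspan.trans (evenSector_eq N).symm⟩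
  rw [Matrix.det_mul, det_matrixT₁, mul_one]
  exact det_matrixT₂_ne_zero hE
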